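/- **Theorem 4.10.** Let $\zeta_3$ be a primitive cube root of unity, $\sqrt{-3} := 2\zeta_3+1$, $k = \mathbb{Q}(\zeta_3)$, and let $\mathcal{O}_F$ denote the ring of integers of a number field $F$. Fix an algebraic closure $\overline{k}$ of $k$. Let $\mathfrak{p}_1 \neq \mathfrak{p}_2$ be finite primes of $k$ with $\mathrm{N}\mathfrak{p}_i \equiv 1 \bmod 9$, and let $\pi_i \in \mathcal{O}_k$ be the generator of $\mathfrak{p}_i$ with $\pi_i \equiv 1 \bmod (3\sqrt{-3})$ $(i=1,2)$. Assume that the cubic residue symbols satisfy $$\left(\frac{\pi_1}{\pi_2}\right)_3 = \left(\frac{\pi_2}{\pi_1}\right)_3 = 1 .$$ Let $K_1 = k(\sqrt[3]{\pi_1}) \subset \overline{k}$, let $\tau \in \mathrm{Gal}(K_1/k)$ be given by $\tau(\sqrt[3]{\pi_1}) = \zeta_3\sqrt[3]{\pi_1}$, let $\mathfrak{P}$ be a prime of $K_1$ lying over $\mathfrak{p}_2$, and put $\mathfrak{P}^{(1)} = \mathfrak{P}$, $\mathfrak{P}^{(2)} = \tau(\mathfrak{P})$. Let $\theta \in \mathcal{O}_{K_1}$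 satisfy the following conditions: * $\mathrm{N}_{K_1/k}(\theta) = \pi_2^3 w^3$ for some $w \in k$; * $(\theta) = (\mathfrak{P}^{(1)})^{2e}(\mathfrak{P}^{(2)})^{e}\mathfrak{A}^{a}$ for some integers $e, a$ with $(e,3)=1$ and $a \equiv 0 \bmod 3$ and some ideal $\mathfrak{A}$ of $\mathcal{O}_{K_1}$ prime to $3$; * there is $\eta \in \mathcal{O}_{K_1}$ with $\eta^3 \equiv \theta \bmod (3\sqrt{-3})$. Put $\theta^{(1)} = \theta$, $\theta^{(2)} = \tau(\theta)$, $\theta^{(3)} = \tau^2(\theta)$, and let $\mathfrak{R}_\theta = k(\sqrt[3]{\pi_1}, \sqrt[3]{\pi_2}, \sqrt[3]{\theta}) \subset \overline{k}$. Then, for any choice of the cube roots: 1. $\mathfrak{R}_\theta = k(\sqrt[3]{\theta^{(1)}}, \sqrt[3]{\theta^{(2)}}, \sqrt[3]{\theta^{(3)}})$. 2. $\mathfrak{R}_\theta/k$ is a Galois extension that is unramified at every place of $k$ (finite or infinite) other than $\mathfrak{p}_1$ and $\mathfrak{p}_2$, and the ramification index of each $\mathfrak{p}_i$ in $\mathfrak{R}_\theta/k$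 is $3$. 3. $\mathrm{Gal}(\mathfrak{R}_\theta/k)$ is isomorphic to the Heisenberg group $N_3(\mathbb{F}_3)$ (of order $27$) of upper triangular $3\times 3$ matrices over $\mathbb{F}_3$ with all diagonal entries equal to $1$. -/

import Mathlib

open NumberField
open scoped IntermediateField nonZeroDivisors

/-- A simple extension `k(ρ)` of a number field by an algebraic element is a number field. -/
instance numberFieldAdjoinSimple {k Ω : Type*} [Field k] [NumberField k] [Field Ω] [Algebra k Ω]
    [Algebra.IsAlgebraic k Ω] (ρ : Ω) : NumberField k⟮ρ⟯ :=
  haveI := IntermediateField.adjoin.finiteDimensional (K := k)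
    (Algebra.IsAlgebraic.isAlgebraic (R := k) ρ).isIntegral
  NumberField.of_module_finite k k⟮ρ⟯

/-- The group `N_n(R)` of upper triangular `n × n` matrices over `R` with all diagonal entries `1`,
as a subgroup of `GL_n(R)` (`Submonoid.units` asks the matrix and its inverse to be of this form;
the latter is automatic).  For `n = 3` this is the Heisenberg group over `R`. -/
def unitriangularGroup (n : ℕ) (R : Type*) [CommRing R] : Subgroup (GL (Fin n) R) :=
  Submonoid.units
    { carrier := {M : Matrix (Fin n) (Fin n) R | (∀ i, M i i = 1) ∧ ∀ i j, j < i → M i j = 0}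
      one_mem' := ⟨fun i => Matrix.one_apply_eq i, fun _ _ h => Matrix.one_apply_ne h.ne'⟩
      mul_mem' := by
        rintro A B ⟨hA, hA'⟩ ⟨hB, hB'⟩
        refine ⟨fun i => ?_, fun i j hij => ?_⟩
        · rw [Matrix.mul_apply, Finset.sum_eq_single i]
          · rw [hA, hB, one_mul]
          · intro l _ hl
            rcases lt_or_gt_of_ne hl with h | h
            · rw [hA' i l h, zero_mul]
            · rw [hB' l i h, mul_zero]
          · simp
        · rw [Matrix.mul_apply]
          refine Finset.sum_eq_zero fun l _ => ?_
          rcases lt_or_ge l i with h | h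
          · rw [hA' i l h, zero_mul]
          · rw [hB' l j (hij.trans_le h), mul_zero] }

section Arithmetic

variable {k : Type*} [Field k] [NumberField k]

/-- The element `3√-3` of the ring of integers of `ℚ(ζ)`, where `ζ = (-1 + √-3)/2` is a
primitive cube root of unity, so that `√-3 = 2ζ + 1`. -/
def threeSqrtNegThree (ζ : 𝓞 k) : 𝓞 k := 3 * (2 * ζ + 1)

/-- `ω` is the cubic residue symbol `(a / 𝔭)₃`: the cube root of unity that is congruent to
`a ^ ((N𝔭 - 1) / 3)` modulo `𝔭`.  It is used for primes `𝔭` with `N𝔭 ≡ 1 mod 9` and `a ∉ 𝔭`, where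
such an `ω` exists and is unique. -/
def IsCubicResidueSymbol (a : 𝓞 k) (𝔭 : Ideal (𝓞 k)) (ω : 𝓞 k) : Prop :=
  ω ^ 3 = 1 ∧ a ^ ((Ideal.absNorm 𝔭 - 1) / 3) - ω ∈ 𝔭

/-- `𝔭` is a finite prime with `N𝔭 ≡ 1 mod 9`, and `π` is its generator with `π ≡ 1 mod 3√-3`. -/
structure IsPrimaryGenerator (ζ : 𝓞 k) (𝔭 : Ideal (𝓞 k)) (π : 𝓞 k) : Prop where
  isPrime : 𝔭.IsPrime
  absNorm_modEq : Ideal.absNorm 𝔭 ≡ 1 [MOD 9]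
  eq_span : 𝔭 = Ideal.span {π}
  congr_one : π - 1 ∈ Ideal.span {threeSqrtNegThree ζ}

variable {K₁ : Type*} [Field K₁] [NumberField K₁] [Algebra k K₁]

/-- The conditions on `θ ∈ 𝓞 K₁`, relative to a prime `𝔓` of `K₁` and a `k`-automorphism `τ` of `K₁`:
* `N(θ) = π₂³ w³` for some `w ∈ k`;
* `(θ) = 𝔓 ^ (2e) · τ(𝔓) ^ e · 𝔄 ^ a` with `e` prime to `3`, `𝔄` an ideal of `𝓞 K₁` prime to `3`, and
  `a` divisible by `3` (an identity of fractional ideals, since `e` and `a` may be negative);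
* `η³ ≡ θ mod 3√-3` for some `η ∈ 𝓞 K₁`. -/
structure IsAdmissible (ζ π₂ : 𝓞 k) (τ : K₁ ≃ₐ[k] K₁) (𝔓 : Ideal (𝓞 K₁)) (θ : 𝓞 K₁) : Prop where
  norm_eq : ∃ w : k, Algebra.norm k (θ : K₁) = (π₂ : k) ^ 3 * w ^ 3
  factorization : ∃ (e a : ℤ) (𝔄 : Ideal (𝓞 K₁)),
    IsCoprime e 3 ∧ IsCoprime 𝔄 (Ideal.span {3}) ∧ 3 ∣ a ∧
      FractionalIdeal.spanSingleton (𝓞 K₁)⁰ (θ : K₁) =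
        (𝔓 : FractionalIdeal (𝓞 K₁)⁰ K₁) ^ (2 * e) *
        ((𝔓.map (RingOfIntegers.mapAlgEquiv τ) : Ideal (𝓞 K₁)) :
          FractionalIdeal (𝓞 K₁)⁰ K₁) ^ e *
        (𝔄 : FractionalIdeal (𝓞 K₁)⁰ K₁) ^ a
  cube_congr : ∃ η : 𝓞 K₁,
    η ^ 3 - θ ∈ Ideal.span {algebraMap (𝓞 k) (𝓞 K₁) (threeSqrtNegThree ζ)}

end Arithmetic

open IsDedekindDomain HeightOneSpectrum

/-!
Let `K₁ = k(ρ₁)`. The factorization of `θ` shows that `τ(θ) / (θ π₂ⁿ)` has valuation divisible by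
`3` at every prime of `K₁`, for some `n` prime to `3`. By Hilbert's theorem 90 the norm condition
makes `τ(θ) / θ` an element of `k` times a cube, and since `k` has class number one that element is
`π₂ⁿ` times a cube up to a cube root of unity, which the congruences modulo `3√-3` force to be `1`.
So `τ(θ) = θ π₂ⁿ x³`. Hence `k(ρ₁, ρ₂, t)` contains cube roots `t`, `t ρ₂ⁿ x`, … of all
conjugates of `θ`, and a lift of `τ` multiplies `t` by `ρ₂ⁿ x`. It therefore fails to commute with
an automorphism moving `ρ₂`, and this noncommutativity is that of the Heisenberg group.

Let `σ` lie in an inertia group at a prime `w`. Away from `√-3`, `σ` fixes a cube root as soon as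
some `σ`-invariant element has the same valuation at `w`; above `√-3` it fixes a cube root of
anything prime to `w` that is congruent to the cube of a `σ`-invariant integer modulo `3√-3`. Thus
`σ` is determined by its action on `ρᵢ` if `w` lies over `𝔭ᵢ`, and is trivial if `w` lies over
neither. Inertia over `𝔭₁` and `𝔭₂`, of order `3`, provides automorphisms moving only one of `ρ₁`
and `ρ₂`, so the Galois group has the full order `27`.
-/

section CubeRoots

theorem sq_add_self_add_one_eq_zero {A : Type*} [CommRing A] [IsDomain A] {ζ : A}
    (hζ : IsPrimitiveRoot ζ 3) : ζ ^ 2 + ζ + 1 = 0 := by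
  simpa [Polynomial.cyclotomic_three] using hζ.isRoot_cyclotomic (by norm_num)

theorem sq_two_mul_add_one {A : Type*} [CommRing A] [IsDomain A] {ζ : A}
    (hζ : IsPrimitiveRoot ζ 3) : (2 * ζ + 1) ^ 2 = -3 := by
  linear_combination 4 * sq_add_self_add_one_eq_zero hζ

theorem associated_sub_one_two_mul_add_one {A : Type*} [CommRing A] [IsDomain A] {ζ ω : A}
    (hζ : IsPrimitiveRoot ζ 3) (hω : ω ^ 3 = 1) (hω1 : ω ≠ 1) :
    Associated (ω - 1) (2 * ζ + 1) := by
  have hz := sq_add_self_add_one_eq_zero hζ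
  obtain ⟨u, rfl⟩ := hζ.isUnit (by norm_num)
  obtain ⟨i, hi, rfl⟩ := hζ.eq_pow_of_pow_eq_one hω
  interval_cases i
  · exact absurd (pow_zero _) hω1
  · exact Associated.symm ⟨-u ^ 2, by push_cast; linear_combination (1 - 2 * (u : A)) * hz⟩
  · exact Associated.symm ⟨u, by linear_combination hz⟩

theorem exists_eq_mul_of_pow_eq_pow {F : Type*} [Field F] {n : ℕ} (hn : n ≠ 0) {a b : F}
    (h : a ^ n = b ^ n) : ∃ ω : F, ω ^ n = 1 ∧ a = ω * b := by
  rcases eq_or_ne b 0 with rfl | hb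
  · exact ⟨1, one_pow n, by simpa [hn] using h⟩
  · exact ⟨a / b, by rw [div_pow, h, div_self (pow_ne_zero n hb)], by field_simp⟩

theorem dvd_of_cube_eq {A : Type*} [CommRing A] [IsDomain A] [IsIntegrallyClosed A]
    {l d a b : A} (h : d ^ 3 = a * l ^ 2 * d + b * l ^ 3) : l ∣ d := by
  rcases eq_or_ne l 0 with rfl | hl
  · simpa using h
  let φ := algebraMap A (FractionRing A)
  have hl' : φ l ≠ 0 := by simpa [φ] using hl
  have hroot : (φ d / φ l) ^ 3 = φ a * (φ d / φ l) + φ b := by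
    have hφ := congrArg φ h
    simp only [map_mul, map_add, map_pow] at hφ
    field_simp
    linear_combination hφ
  have hint : IsIntegral A (φ d / φ l) := by
    refine ⟨.X ^ 3 - (.C a * .X + .C b), Polynomial.monic_X_pow_sub (by compute_degree!), ?_⟩
    simpa [sub_eq_zero] using hroot
  obtain ⟨y, hy⟩ := IsIntegrallyClosed.isIntegral_iff.1 hint
  refine ⟨y, FaithfulSMul.algebraMap_injective A (FractionRing A) ?_⟩
  rw [map_mul, hy]
  exact (mul_div_cancel₀ (φ d) hl').symm

end CubeRoots

section Inertia

/-- With `√-3 = 2ζ + 1`, the quotient `(t - η) / √-3` is integral, so `σ` moves it by an element of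
`P`; but it moves it by a unit multiple of `t` if `ω ≠ 1`. -/
theorem eq_one_of_mem_inertia_of_congr_cube {G A : Type*} [CommRing A] [IsDomain A]
    [IsIntegrallyClosed A] [CharZero A] [Group G] [MulSemiringAction G A] {P : Ideal A}
    {σ : G} (hσ : σ ∈ P.inertia G) {ζ ω t η : A} (hζ : IsPrimitiveRoot ζ 3) (hσζ : σ • ζ = ζ)
    (hω : ω ^ 3 = 1) (ht : t ∉ P) (hσt : σ • t = ω * t) (hση : σ • η = η)
    (h : 3 * (2 * ζ + 1) ∣ t ^ 3 - η ^ 3) : ω = 1 := by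
  by_contra hω1
  obtain ⟨u, hu⟩ := (associated_sub_one_two_mul_add_one hζ hω hω1).symm
  obtain ⟨c, hc⟩ := h
  have hl2 := sq_two_mul_add_one hζ
  have hσl : σ • (2 * ζ + 1) = 2 * ζ + 1 := by
    simp only [two_mul, smul_add, hσζ, smul_one]
  have hl0 : 2 * ζ + 1 ≠ 0 := fun h0 ↦ by simp [h0] at hl2
  generalize 2 * ζ + 1 = l at hu hc hl2 hσl hl0
  obtain ⟨y, hy⟩ : l ∣ t - η :=
    dvd_of_cube_eq (a := t * η) (b := -c)
      (by linear_combination hc + (c * l - t * η * (t - η)) * hl2)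
  have hmul : l * (σ • y - y) = l * (t * u) := by
    have hσy : σ • t - σ • η = l * σ • y := by rw [← smul_sub, hy, smul_mul', hσl]
    linear_combination -hσy + hσt - hση - t * hu + hy
  have htu : t * u ∈ P := mul_left_cancel₀ hl0 hmul ▸ hσ y
  exact ht ((P.mul_unit_mem_iff_mem u.isUnit).1 htu)

variable {F L : Type*} [Field F] [Field L] [NumberField L] [Algebra F L]
  {w : HeightOneSpectrum (𝓞 L)} {σ : L ≃ₐ[F] L}

theorem valuation_apply_sub_lt_one_of_mem_inertia (hσ : σ ∈ w.asIdeal.inertia (L ≃ₐ[F] L)) {u : L}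
    (hu : w.valuation L u ≤ 1) : w.valuation L (σ u - u) < 1 := by
  obtain ⟨n, ⟨d, hd⟩, hud⟩ := exists_primeCompl_mul_eq_of_integer w u hu
  replace hd : d ∉ w.asIdeal := hd
  replace hud : u * d = n := hud
  have hσd : σ • d ∉ w.asIdeal := fun h ↦ hd (by simpa using w.asIdeal.sub_mem h (hσ d))
  have hmem : (σ • n - n) * d - n * (σ • d - d) ∈ w.asIdeal :=
    w.asIdeal.sub_mem (w.asIdeal.mul_mem_right _ (hσ n)) (w.asIdeal.mul_mem_left _ (hσ d))
  have hσud : algebraMap (𝓞 L) L (σ • n) = σ u * algebraMap (𝓞 L) L (σ • d) :=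
    (congrArg σ hud).symm.trans (map_mul σ u d)
  have key : algebraMap (𝓞 L) L ((σ • n - n) * d - n * (σ • d - d)) =
      (σ u - u) * algebraMap (𝓞 L) L d * algebraMap (𝓞 L) L (σ • d) := by
    simp only [map_sub, map_mul, hσud, ← hud]
    ring
  have hval : ∀ z : 𝓞 L, z ∉ w.asIdeal → w.valuation L (algebraMap (𝓞 L) L z) = 1 :=
    fun z hz ↦ (valuation_eq_one_iff_notMem w).2 hz
  have h : w.valuation L (algebraMap (𝓞 L) L _) < 1 := (valuation_lt_one_iff_mem w _).2 hmem
  rwa [key, map_mul, map_mul, hval d hd, hval _ hσd, mul_one, mul_one] at h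

theorem eq_one_of_mem_inertia_of_valuation_eq (hσ : σ ∈ w.asIdeal.inertia (L ≃ₐ[F] L)) {ζ ω : 𝓞 L}
    (hζ : IsPrimitiveRoot ζ 3) (hζw : 2 * ζ + 1 ∉ w.asIdeal) (hω : ω ^ 3 = 1) {u c : L}
    (hu : u ≠ 0) (hσu : σ u = ω * u) (hσc : σ c = c) (huc : w.valuation L u = w.valuation L c) :
    ω = 1 := by
  by_contra hω1
  obtain ⟨ε, hε⟩ := (associated_sub_one_two_mul_add_one hζ hω hω1).symm
  have hdiv : w.valuation L (u / c) = 1 := by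
    rw [map_div₀, ← huc, div_self ((Valuation.ne_zero_iff _).2 hu)]
  have hσuc : σ (u / c) - u / c = ((ω - 1 : 𝓞 L) : L) * (u / c) := by
    rw [map_div₀, hσu, hσc]
    push_cast
    ring
  have hlt := valuation_apply_sub_lt_one_of_mem_inertia hσ hdiv.le
  rw [hσuc, map_mul, hdiv, mul_one, valuation_lt_one_iff_mem, ← hε] at hlt
  exact hζw ((w.asIdeal.mul_unit_mem_iff_mem ε.isUnit).1 hlt)

variable [NumberField F] [IsGalois F L]

theorem card_inertia_eq_ramificationIdx (w : HeightOneSpectrum (𝓞 L)) :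
    Nat.card (w.asIdeal.inertia (L ≃ₐ[F] L)) = w.asIdeal.ramificationIdx (𝓞 F) := by
  have : (w.asIdeal.under (𝓞 F)).IsMaximal := inferInstance
  rw [Ideal.card_inertia_eq_ramificationIdxIn (w.asIdeal.under (𝓞 F)) w.asIdeal,
    Ideal.ramificationIdxIn_eq_ramificationIdx _ w.asIdeal (L ≃ₐ[F] L)]

theorem isUnramifiedAt_of_inertia_eq_bot (h : w.asIdeal.inertia (L ≃ₐ[F] L) = ⊥) :
    Algebra.IsUnramifiedAt (𝓞 F) w.asIdeal := by
  have : (w.asIdeal.under (𝓞 F)).IsMaximal := inferInstance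
  rw [← Ideal.ramificationIdx_eq_one_iff, ← card_inertia_eq_ramificationIdx, h, Subgroup.card_bot]

end Inertia

section Order

variable {R K : Type*} [CommRing R] [IsDedekindDomain R] [Field K] [Algebra R K]
  [IsFractionRing R K]

/-- The additive valuation of `x` at the prime `v`, with the junk value `primeOrd v 0 = 0`. -/
noncomputable def primeOrd (v : HeightOneSpectrum R) (x : K) : ℤ :=
  -WithZero.log (v.valuation K x)

theorem valuation_ne_zero (v : HeightOneSpectrum R) {x : K} (hx : x ≠ 0) :
    v.valuation K x ≠ 0 :=
  (Valuation.ne_zero_iff _).2 hx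

theorem valuation_eq_exp_neg_primeOrd (v : HeightOneSpectrum R) {x : K} (hx : x ≠ 0) :
    v.valuation K x = WithZero.exp (-primeOrd v x) := by
  rw [primeOrd, neg_neg, WithZero.exp_log (valuation_ne_zero v hx)]

theorem valuation_eq_iff_primeOrd_eq (v : HeightOneSpectrum R) {x y : K} (hx : x ≠ 0)
    (hy : y ≠ 0) : v.valuation K x = v.valuation K y ↔ primeOrd v x = primeOrd v y := by
  rw [valuation_eq_exp_neg_primeOrd v hx, valuation_eq_exp_neg_primeOrd v hy, WithZero.exp_inj,
    neg_inj]

theorem primeOrd_mul (v : HeightOneSpectrum R) {x y : K} (hx : x ≠ 0) (hy : y ≠ 0) :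
    primeOrd v (x * y) = primeOrd v x + primeOrd v y := by
  rw [primeOrd, map_mul, WithZero.log_mul (valuation_ne_zero v hx) (valuation_ne_zero v hy),
    neg_add, primeOrd, primeOrd]

theorem primeOrd_pow (v : HeightOneSpectrum R) (x : K) (n : ℕ) :
    primeOrd v (x ^ n) = n * primeOrd v x := by
  simp [primeOrd]

theorem primeOrd_inv (v : HeightOneSpectrum R) (x : K) : primeOrd v x⁻¹ = -primeOrd v x := by
  simp [primeOrd]

theorem primeOrd_div (v : HeightOneSpectrum R) {x y : K} (hx : x ≠ 0) (hy : y ≠ 0) :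
    primeOrd v (x / y) = primeOrd v x - primeOrd v y := by
  rw [div_eq_mul_inv, primeOrd_mul v hx (inv_ne_zero hy), primeOrd_inv, sub_eq_add_neg]

theorem primeOrd_zpow (v : HeightOneSpectrum R) (x : K) (n : ℤ) :
    primeOrd v (x ^ n) = n * primeOrd v x := by
  simp [primeOrd, WithZero.log_zpow]

theorem exists_primeOrd_eq (v : HeightOneSpectrum R) (m : ℤ) :
    ∃ z : K, z ≠ 0 ∧ primeOrd v z = m := by
  obtain ⟨p, hp⟩ := v.valuation_exists_uniformizer K
  have hp0 : p ≠ 0 := (Valuation.ne_zero_iff _).1 (hp ▸ WithZero.exp_ne_zero)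
  refine ⟨p ^ m, zpow_ne_zero m hp0, ?_⟩
  rw [primeOrd_zpow, primeOrd, hp, WithZero.log_exp, neg_neg, mul_one]

theorem mem_asIdeal_pow_iff_le_primeOrd (v : HeightOneSpectrum R) {r : R} (hr : r ≠ 0) (n : ℕ) :
    r ∈ v.asIdeal ^ n ↔ n ≤ primeOrd v (algebraMap R K r) := by
  rw [← v.intValuation_le_pow_iff_mem, ← v.valuation_of_algebraMap (K := K),
    valuation_eq_exp_neg_primeOrd v (by simpa using hr), WithZero.exp_le_exp, neg_le_neg_iff]

theorem primeOrd_algebraMap_eq_zero_iff (v : HeightOneSpectrum R) {r : R} (hr : r ≠ 0) :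
    primeOrd v (algebraMap R K r) = 0 ↔ r ∉ v.asIdeal := by
  have hr' : algebraMap R K r ≠ 0 := by simpa using hr
  rw [← v.valuation_eq_one_iff_notMem (K := K), valuation_eq_exp_neg_primeOrd v hr',
    ← WithZero.exp_zero, WithZero.exp_inj, neg_eq_zero]

theorem count_spanSingleton_eq_primeOrd (v : HeightOneSpectrum R) {x : K} (hx : x ≠ 0) :
    FractionalIdeal.count K v (FractionalIdeal.spanSingleton R⁰ x) = primeOrd v x := by
  have integral (r : R) (hr : r ≠ 0) :
      FractionalIdeal.count K v (FractionalIdeal.spanSingleton R⁰ (algebraMap R K r)) =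
        primeOrd v (algebraMap R K r) := by
    rw [← FractionalIdeal.coeIdeal_span_singleton,
      FractionalIdeal.count_coe K v (by simpa using hr), primeOrd, valuation_of_algebraMap,
      intValuation_if_neg v hr, WithZero.log_exp, neg_neg]
  obtain ⟨n, d, -, rfl⟩ := IsFractionRing.div_surjective (A := R) x
  have hn0 : algebraMap R K n ≠ 0 := (div_ne_zero_iff.1 hx).1
  have hd0 : algebraMap R K d ≠ 0 := (div_ne_zero_iff.1 hx).2
  rw [primeOrd_div v hn0 hd0, div_eq_mul_inv, ← FractionalIdeal.spanSingleton_mul_spanSingleton,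
    FractionalIdeal.count_mul K v (FractionalIdeal.spanSingleton_ne_zero_iff.2 hn0)
      (FractionalIdeal.spanSingleton_ne_zero_iff.2 (inv_ne_zero hd0)),
    ← FractionalIdeal.spanSingleton_inv, FractionalIdeal.count_inv,
    integral n (by simpa using hn0), integral d (by simpa using hd0), sub_eq_add_neg]

theorem exists_eq_unit_mul_pow [IsPrincipalIdealRing R] {x : K} (hx : x ≠ 0) (n : ℕ)
    (h : ∀ v : HeightOneSpectrum R, (n : ℤ) ∣ primeOrd v x) :
    ∃ (u : Rˣ) (c : K), x = algebraMap R K u * c ^ n := by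
  have hI : FractionalIdeal.spanSingleton R⁰ x ≠ 0 := FractionalIdeal.spanSingleton_ne_zero_iff.2 hx
  let m (v : HeightOneSpectrum R) : ℤ := primeOrd v x / n
  let J : FractionalIdeal R⁰ K :=
    ∏ᶠ v : HeightOneSpectrum R, (v.asIdeal : FractionalIdeal R⁰ K) ^ m v
  have hJ : J ^ n = FractionalIdeal.spanSingleton R⁰ x := by
    rw [← FractionalIdeal.finprod_heightOneSpectrum_factorization' K hI, finprod_pow]
    · refine finprod_congr fun v ↦ ?_
      rw [← zpow_natCast, ← zpow_mul, count_spanSingleton_eq_primeOrd v hx,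
        Int.ediv_mul_cancel (h v)]
    · refine (FractionalIdeal.finite_factors (K := K)
        (FractionalIdeal.spanSingleton R⁰ x)).subset fun v hv hv0 ↦ hv ?_
      have hv0' : primeOrd v x = 0 := (count_spanSingleton_eq_primeOrd v hx).symm.trans hv0
      simp [m, hv0']
  obtain ⟨c, hc⟩ := (FractionalIdeal.isPrincipal_iff J).1 inferInstance
  rw [hc, FractionalIdeal.spanSingleton_pow] at hJ
  obtain ⟨u, hu⟩ := FractionalIdeal.spanSingleton_eq_spanSingleton.1 hJ
  exact ⟨u, c, by rw [← hu, Units.smul_def, Algebra.smul_def]⟩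

variable {S L : Type*} [CommRing S] [IsDedekindDomain S] [Field L] [Algebra S L]
  [IsFractionRing S L] [Algebra R S] [Algebra K L] [Algebra R L] [IsScalarTower R K L]
  [IsScalarTower R S L] [FaithfulSMul R S] [Algebra.IsIntegral R S]

theorem primeOrd_algebraMap (w : HeightOneSpectrum S) (x : K) :
    primeOrd w (algebraMap K L x) =
      w.asIdeal.ramificationIdx R * primeOrd (w.under R) x := by
  have : w.asIdeal.LiesOver (w.under R).asIdeal := ⟨rfl⟩
  rw [primeOrd, ← valuation_liesOver L (w.under R) w x, WithZero.log_pow,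
    Ideal.ramificationIdx'_eq_ramificationIdx _ w.asIdeal (w.under R).ne_bot, nsmul_eq_mul,
    primeOrd, mul_neg]

theorem exists_under_eq (v : HeightOneSpectrum R) :
    ∃ w : HeightOneSpectrum S, w.under R = v := by
  obtain ⟨Q, hQ, hQv⟩ := Ideal.exists_ideal_over_prime_of_isIntegral_of_isDomain (S := S) v.asIdeal
    (by simp [(RingHom.injective_iff_ker_eq_bot _).1 (FaithfulSMul.algebraMap_injective R S)])
  refine ⟨⟨Q, hQ, ?_⟩, HeightOneSpectrum.ext hQv⟩
  rintro rfl
  exact v.ne_bot (hQv ▸ Ideal.comap_bot_of_injective _ (FaithfulSMul.algebraMap_injective R S))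

end Order

section Conjugate

open scoped Pointwise

variable {G R : Type*} [Group G] [CommRing R] [MulSemiringAction G R]

/-- The action on the primes of `R` induced by an action on `R`: `σ • w` is the prime `σ(w)`. -/
instance heightOneSpectrumMulAction : MulAction G (HeightOneSpectrum R) where
  smul σ w :=
    { asIdeal := σ • w.asIdeal
      isPrime := inferInstance
      ne_bot := fun h ↦ w.ne_bot (by
        rw [← inv_smul_smul σ w.asIdeal, h, Ideal.pointwise_smul_def, Ideal.map_bot]) }
  one_smul w := HeightOneSpectrum.ext (one_smul G w.asIdeal)
  mul_smul σ τ w := HeightOneSpectrum.ext (mul_smul σ τ w.asIdeal)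

theorem asIdeal_smul (σ : G) (w : HeightOneSpectrum R) : (σ • w).asIdeal = σ • w.asIdeal :=
  rfl

variable [IsDedekindDomain R]

theorem intValuation_smul (σ : G) (w : HeightOneSpectrum R) (r : R) :
    (σ • w).intValuation (σ • r) = w.intValuation r := by
  rcases eq_or_ne r 0 with rfl | hr
  · simp
  have hr' : σ • r ≠ 0 := (smul_ne_zero_iff_ne σ).2 hr
  have hspan : Ideal.span {σ • r} = σ • Ideal.span {r} := by
    rw [Ideal.pointwise_smul_def, Ideal.map_span, Set.image_singleton]
    rfl
  rw [intValuation_eq_exp_neg_multiplicity _ hr, intValuation_eq_exp_neg_multiplicity _ hr',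
    hspan, asIdeal_smul]
  congr 3
  exact multiplicity_map_eq (MulDistribMulAction.toMulEquiv (Ideal R) σ)

theorem primeOrd_smul {K : Type*} [Field K] [Algebra R K] [IsFractionRing R K]
    [MulSemiringAction G K] [SMulDistribClass G R K] (σ : G) (w : HeightOneSpectrum R) (x : K) :
    primeOrd (σ • w) (σ • x) = primeOrd w x := by
  obtain ⟨n, d, -, rfl⟩ := IsFractionRing.div_surjective (A := R) x
  simp only [primeOrd, smul_div₀', ← algebraMap.coe_smul', map_div₀, valuation_of_algebraMap,
    intValuation_smul]

end Conjugate

section KummerInertia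

variable {F L : Type*} [Field F] [Field L] [Algebra F L]

theorem smul_algebraMap_integer (σ : L ≃ₐ[F] L) (x : 𝓞 F) :
    σ • algebraMap (𝓞 F) (𝓞 L) x = algebraMap (𝓞 F) (𝓞 L) x :=
  RingOfIntegers.coe_injective (σ.commutes (algebraMap (𝓞 F) F x))

theorem algebraMap_threeSqrtNegThree (ζ : 𝓞 F) :
    algebraMap (𝓞 F) (𝓞 L) (threeSqrtNegThree ζ) = 3 * (2 * algebraMap (𝓞 F) (𝓞 L) ζ + 1) := by
  simp only [threeSqrtNegThree, map_mul, map_add, map_one, map_ofNat]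

theorem exists_integer_eq_of_pow_eq {ρ : L} {n : ℕ} (hn : n ≠ 0) {a : 𝓞 L} (h : ρ ^ n = a) :
    ∃ r : 𝓞 L, (r : L) = ρ ∧ r ^ n = a := by
  have hint : IsIntegral ℤ ρ :=
    IsIntegral.of_pow (Nat.pos_of_ne_zero hn) (h ▸ RingOfIntegers.isIntegral_coe a)
  exact ⟨⟨ρ, hint⟩, rfl, RingOfIntegers.coe_injective h⟩

theorem exists_integer_eq_mul_of_pow_eq_pow {n : ℕ} (hn : n ≠ 0) {a b : L} (h : a ^ n = b ^ n) :
    ∃ ω : 𝓞 L, ω ^ n = 1 ∧ a = ω * b := by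
  obtain ⟨ω', hω', hab⟩ := exists_eq_mul_of_pow_eq_pow hn h
  obtain ⟨ω, rfl, hω⟩ :=
    exists_integer_eq_of_pow_eq (a := 1) hn (hω'.trans (map_one (algebraMap (𝓞 L) L)).symm)
  exact ⟨ω, hω, hab⟩

variable [NumberField L] {w : HeightOneSpectrum (𝓞 L)} {σ : L ≃ₐ[F] L}

theorem apply_eq_of_mem_inertia_of_congr_cube (hσ : σ ∈ w.asIdeal.inertia (L ≃ₐ[F] L))
    {ζ a η : 𝓞 L} (hζ : IsPrimitiveRoot ζ 3) (hσζ : σ • ζ = ζ) {t : L} (ht : t ^ 3 = a)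
    (ha : a ∉ w.asIdeal) (hσa : σ • a = a) (hση : σ • η = η) (h : 3 * (2 * ζ + 1) ∣ a - η ^ 3) :
    σ t = t := by
  obtain ⟨r, rfl, hr⟩ := exists_integer_eq_of_pow_eq three_ne_zero ht
  have hrw : r ∉ w.asIdeal := fun hm ↦ ha (hr ▸ w.asIdeal.pow_mem_of_mem hm 3 three_pos)
  obtain ⟨ω, hω, hσr⟩ := exists_integer_eq_mul_of_pow_eq_pow three_ne_zero
    (show σ r ^ 3 = (r : L) ^ 3 by rw [← map_pow, ht]; exact congrArg (algebraMap (𝓞 L) L) hσa)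
  have hω1 : ω = 1 := eq_one_of_mem_inertia_of_congr_cube hσ hζ hσζ hω hrw
    (RingOfIntegers.coe_injective (hσr.trans (map_mul _ _ _).symm)) hση (hr ▸ h)
  rw [hσr, hω1]
  exact one_mul _

theorem apply_eq_of_mem_inertia_of_valuation_eq (hσ : σ ∈ w.asIdeal.inertia (L ≃ₐ[F] L))
    {ζ : 𝓞 L} (hζ : IsPrimitiveRoot ζ 3) (hζw : 2 * ζ + 1 ∉ w.asIdeal) {t c : L} (ht : t ≠ 0)
    (hσt : σ t ^ 3 = t ^ 3) (hσc : σ c = c) (htc : w.valuation L t = w.valuation L c) :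
    σ t = t := by
  obtain ⟨ω, hω, hσω⟩ := exists_integer_eq_mul_of_pow_eq_pow three_ne_zero hσt
  rw [hσω, eq_one_of_mem_inertia_of_valuation_eq hσ hζ hζw hω ht hσω hσc htc]
  exact one_mul _

theorem apply_eq_of_mem_inertia_of_cube_eq {ζ π : 𝓞 F}
    (hσ : σ ∈ w.asIdeal.inertia (L ≃ₐ[F] L)) (hζ : IsPrimitiveRoot ζ 3)
    (hπ : threeSqrtNegThree ζ ∣ π - 1) {ρ : L} (hρ : ρ ^ 3 = algebraMap (𝓞 F) L π)
    (hw : algebraMap (𝓞 F) (𝓞 L) π ∉ w.asIdeal) : σ ρ = ρ := by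
  have hζ' := hζ.map_of_injective (FaithfulSMul.algebraMap_injective (𝓞 F) (𝓞 L))
  by_cases hl : 2 * algebraMap (𝓞 F) (𝓞 L) ζ + 1 ∈ w.asIdeal
  · refine apply_eq_of_mem_inertia_of_congr_cube hσ hζ' (smul_algebraMap_integer σ ζ)
      (a := algebraMap (𝓞 F) (𝓞 L) π) hρ hw (smul_algebraMap_integer σ π) (smul_one σ) ?_
    rw [one_pow, ← algebraMap_threeSqrtNegThree]
    simpa only [map_sub, map_one] using map_dvd (algebraMap (𝓞 F) (𝓞 L)) hπ
  · have hval : w.valuation L ρ = 1 := by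
      rw [← pow_eq_one_iff_of_nonneg zero_le three_ne_zero, ← map_pow, hρ]
      exact w.valuation_eq_one_iff_notMem.2 hw
    refine apply_eq_of_mem_inertia_of_valuation_eq hσ hζ' hl ?_ ?_ (map_one σ) ?_
    · exact (Valuation.ne_zero_iff _).1 (hval ▸ one_ne_zero)
    · rw [← map_pow, hρ]
      exact σ.commutes _
    · rw [hval, map_one]

end KummerInertia

section Kummer

variable {k K : Type*} [Field k] [Field K] [Algebra k K]

theorem algHom_ext_of_adjoin_eq_top {E : Type*} [Field E] [Algebra k E] {S : Set K}
    (hgen : IntermediateField.adjoin k S = ⊤) {f g : K →ₐ[k] E} (h : ∀ x ∈ S, f x = g x) :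
    f = g := by
  have heq : f.comp (⊤ : IntermediateField k K).val = g.comp (⊤ : IntermediateField k K).val :=
    IntermediateField.algHom_ext_of_eq_adjoin k hgen.symm fun x hx ↦ h x hx
  exact AlgHom.ext fun x ↦ DFunLike.congr_fun heq ⟨x, IntermediateField.mem_top⟩

/-- Hilbert's theorem 90 for a cyclic group, in all universes;
`groupCohomology.exists_div_of_norm_eq_one` is limited to fields in `Type`. -/
theorem exists_eq_mul_apply_of_prod_eq_one {τ : K ≃ₐ[k] K} (hτ : IsOfFinOrder τ) {δ : K}
    (hδ : ∏ i ∈ Finset.range (orderOf τ), (τ ^ i) δ = 1) : ∃ κ : K, κ ≠ 0 ∧ κ = δ * τ κ := by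
  let c (i : ℕ) : K := ∏ j ∈ Finset.range i, (τ ^ j) δ
  have hc (i : ℕ) : c (i + 1) = δ * τ (c i) := by
    simp only [c, Finset.prod_range_succ', map_prod, pow_zero, AlgEquiv.one_apply, pow_succ',
      AlgEquiv.mul_apply, mul_comm δ]
  let r (x : K) : K := ∑ i ∈ Finset.range (orderOf τ), c i * (τ ^ i) x
  have hr (x : K) : r x = δ * τ (r x) := by
    have hsum : δ * τ (r x) = ∑ i ∈ Finset.range (orderOf τ), c (i + 1) * (τ ^ (i + 1)) x := by
      simp only [r, hc, map_sum, map_mul, Finset.mul_sum, pow_succ', AlgEquiv.mul_apply, mul_assoc]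
    have hshift := (Finset.sum_range_succ' (fun i ↦ c i * (τ ^ i) x) (orderOf τ)).symm.trans
      (Finset.sum_range_succ _ _)
    have hends : c (orderOf τ) * (τ ^ orderOf τ) x = c 0 * (τ ^ 0) x := by
      simp only [c, hδ, pow_orderOf_eq_one, Finset.prod_range_zero, pow_zero]
    rw [hends] at hshift
    exact (hsum.trans (add_right_cancel hshift)).symm
  suffices ∃ x, r x ≠ 0 from this.elim fun x hx ↦ ⟨r x, hx, hr x⟩
  by_contra! hzero
  -- Dedekind: the distinct characters `1, τ, τ², …` are linearly independent.
  have hinj : Function.Injective fun i : Fin (orderOf τ) ↦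
      ((τ ^ (i : ℕ) : K ≃ₐ[k] K) : K →* K) := by
    intro i j hij
    exact Fin.ext (pow_injOn_Iio_orderOf i.2 j.2 (AlgEquiv.ext fun x ↦ DFunLike.congr_fun hij x))
  have hind := Fintype.linearIndependent_iff.1 ((linearIndependent_monoidHom K K).comp _ hinj)
    (fun i ↦ c i) (funext fun x ↦ by simpa [r, Finset.sum_range] using hzero x)
    ⟨0, hτ.orderOf_pos⟩
  simp [c] at hind

theorem mem_of_pow_eq_pow {n : ℕ} [NeZero n] {ζ : k} (hζ : IsPrimitiveRoot ζ n)
    {F : IntermediateField k K} {a b : K} (hb : b ∈ F) (h : a ^ n = b ^ n) : a ∈ F := by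
  obtain ⟨ω, hω, rfl⟩ := exists_eq_mul_of_pow_eq_pow (NeZero.ne n) h
  obtain ⟨i, -, rfl⟩ :=
    (hζ.map_of_injective (algebraMap k K).injective).eq_pow_of_pow_eq_one hω
  exact F.mul_mem (pow_mem (F.algebraMap_mem ζ) i) hb

theorem mem_of_coprime_of_pow_mem {F : IntermediateField k K} {a : K} {m n : ℕ}
    (hmn : m.Coprime n) (hm : a ^ m ∈ F) (hn : a ^ n ∈ F) : a ∈ F := by
  rcases eq_or_ne a 0 with rfl | ha
  · exact F.zero_mem
  have hbezout : (m * m.gcdA n + n * m.gcdB n : ℤ) = 1 := by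
    rw [← Nat.gcd_eq_gcd_ab, hmn.gcd_eq_one, Nat.cast_one]
  rw [← zpow_one a, ← hbezout, zpow_add₀ ha, zpow_mul, zpow_mul, zpow_natCast, zpow_natCast]
  exact F.mul_mem (zpow_mem hm _) (zpow_mem hn _)

/-- `K = k(ρ)` with `ρ ^ n = a`, and the automorphism `τ` multiplies `ρ` by the primitive `n`-th
root of unity `ζ ∈ k`; the existence of `τ` forces `[K : k] = n`. -/
structure IsKummerExtension (n : ℕ) (ζ a : k) (ρ : K) (τ : K ≃ₐ[k] K) : Prop where
  zeta : IsPrimitiveRoot ζ n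
  root_ne_zero : ρ ≠ 0
  root_pow : ρ ^ n = algebraMap k K a
  adjoin_eq_top : k⟮ρ⟯ = ⊤
  apply_root : τ ρ = algebraMap k K ζ * ρ

namespace IsKummerExtension

variable {n : ℕ} {ζ a : k} {ρ : K} {τ : K ≃ₐ[k] K} (h : IsKummerExtension n ζ a ρ τ)
include h

theorem ext_root {f g : K ≃ₐ[k] K} (hfg : f ρ = g ρ) : f = g :=
  AlgEquiv.coe_toAlgHom_injective
    (algHom_ext_of_adjoin_eq_top h.adjoin_eq_top (by simpa using hfg))

theorem apply_algebraMap_eq {L : Type*} [Field L] [Algebra k L] [Algebra K L] [IsScalarTower k K L]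
    {f : K ≃ₐ[k] K} {g : L →ₐ[k] L} (hfg : g (algebraMap K L ρ) = algebraMap K L (f ρ)) (x : K) :
    g (algebraMap K L x) = algebraMap K L (f x) := by
  have hext : g.comp (IsScalarTower.toAlgHom k K L) =
      (IsScalarTower.toAlgHom k K L).comp (f : K →ₐ[k] K) :=
    algHom_ext_of_adjoin_eq_top h.adjoin_eq_top (by simpa using hfg)
  exact DFunLike.congr_fun hext x

theorem pow_apply_root (i : ℕ) : (τ ^ i) ρ = algebraMap k K (ζ ^ i) * ρ := by
  induction i with
  | zero => simp
  | succ i ih =>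
    rw [pow_succ', AlgEquiv.mul_apply, ih, map_mul, AlgEquiv.commutes, h.apply_root, pow_succ,
      map_mul, mul_assoc]

theorem orderOf_eq : orderOf τ = n := by
  refine Nat.dvd_antisymm (orderOf_dvd_of_pow_eq_one (h.ext_root ?_))
    (h.zeta.dvd_of_pow_eq_one _ ?_)
  · rw [h.pow_apply_root, h.zeta.pow_eq_one, map_one, one_mul, AlgEquiv.one_apply]
  · have hρ := h.pow_apply_root (orderOf τ)
    rw [pow_orderOf_eq_one, AlgEquiv.one_apply, eq_comm, mul_eq_right₀ h.root_ne_zero] at hρ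
    exact (algebraMap k K).injective (hρ.trans (map_one _).symm)

section

variable [NeZero n]

theorem isOfFinOrder : IsOfFinOrder τ :=
  orderOf_pos_iff.1 (h.orderOf_eq ▸ NeZero.pos n)

theorem exists_eq_pow (g : K ≃ₐ[k] K) : ∃ i : ℕ, g = τ ^ i := by
  obtain ⟨ω, hω, hg⟩ := exists_eq_mul_of_pow_eq_pow (NeZero.ne n)
    (show g ρ ^ n = ρ ^ n by rw [← map_pow, h.root_pow, AlgEquiv.commutes])
  obtain ⟨i, -, rfl⟩ :=
    (h.zeta.map_of_injective (algebraMap k K).injective).eq_pow_of_pow_eq_one hω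
  exact ⟨i, h.ext_root (by rw [hg, h.pow_apply_root, map_pow])⟩

theorem mem_zpowers (g : K ≃ₐ[k] K) : g ∈ Subgroup.zpowers τ := by
  obtain ⟨i, rfl⟩ := h.exists_eq_pow g
  exact pow_mem (Subgroup.mem_zpowers τ) i

theorem isGalois : IsGalois k K := by
  have ha : a ≠ 0 := by
    rintro rfl
    exact h.root_ne_zero (eq_zero_of_pow_eq_zero (h.root_pow.trans (map_zero _)))
  have hroot : ρ ∈ (.X ^ n - .C a : Polynomial k).rootSet K := by
    rw [Polynomial.mem_rootSet]
    exact ⟨Polynomial.X_pow_sub_C_ne_zero (NeZero.pos n) a, by simp [h.root_pow]⟩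
  have : Polynomial.IsSplittingField k K (.X ^ n - .C a) := by
    refine isSplittingField_iff_intermediateField.2 ⟨?_, ?_⟩
    · simpa using X_pow_sub_C_splits_of_isPrimitiveRoot
        (h.zeta.map_of_injective (algebraMap k K).injective) h.root_pow
    · rw [eq_top_iff, ← h.adjoin_eq_top]
      exact IntermediateField.adjoin.mono k _ _ (Set.singleton_subset_iff.2 hroot)
  have := h.zeta.neZero'
  exact .of_separable_splitting_field
    (Polynomial.separable_X_pow_sub_C a (NeZero.ne (n : k)) ha)

theorem norm_eq_prod [FiniteDimensional k K] (x : K) :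
    algebraMap k K (Algebra.norm k x) = ∏ i ∈ Finset.range n, (τ ^ i) x := by
  classical
  have := h.isGalois
  rw [Algebra.norm_eq_prod_automorphisms, ← IsCyclic.image_range_orderOf h.mem_zpowers,
    Finset.prod_image, h.orderOf_eq]
  exact fun i hi j hj ↦ pow_injOn_Iio_orderOf (by simpa using hi) (by simpa using hj)

theorem exists_algebraMap_eq_of_apply_eq [FiniteDimensional k K] {x : K} (hx : τ x = x) :
    ∃ b : k, algebraMap k K b = x := by
  have := h.isGalois
  rw [← Set.mem_range, ← IntermediateField.mem_bot, IsGalois.mem_bot_iff_fixed]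
  intro g
  have hτ : τ ∈ MulAction.stabilizer (K ≃ₐ[k] K) x := hx
  exact Subgroup.zpowers_le_of_mem hτ (h.mem_zpowers g)

end

variable {Ω : Type*} [Field Ω] [Algebra k Ω] [Algebra K Ω] [IsScalarTower k K Ω]
  {F : IntermediateField k Ω}

theorem algebraMap_mem_of_root_mem (hρ : algebraMap K Ω ρ ∈ F) (x : K) : algebraMap K Ω x ∈ F := by
  have hle : k⟮ρ⟯ ≤ F.comap (IsScalarTower.toAlgHom k K Ω) :=
    IntermediateField.adjoin_simple_le_iff.2 hρ
  exact hle (h.adjoin_eq_top ▸ IntermediateField.mem_top)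

theorem algebraMap_mem_of_apply_ne [FiniteDimensional k K] [hn : Fact n.Prime] {y : K}
    (hτy : τ y ≠ y) (hy : algebraMap K Ω y ∈ F) (x : K) : algebraMap K Ω x ∈ F := by
  have := h.isGalois
  let E : IntermediateField k K := F.comap (IsScalarTower.toAlgHom k K Ω)
  have hcard : Nat.card (K ≃ₐ[k] K) = n := by
    rw [← h.orderOf_eq, orderOf_eq_card_of_forall_mem_zpowers h.mem_zpowers]
  have : Fact (Nat.card (K ≃ₐ[k] K)).Prime := by rwa [hcard]
  have hE : E.fixingSubgroup = ⊥ := by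
    refine E.fixingSubgroup.eq_bot_or_eq_top_of_prime_card.resolve_right fun htop ↦ hτy ?_
    exact (mem_fixingSubgroup_iff _).1 (htop ▸ Subgroup.mem_top τ) y hy
  have hx : x ∈ E := by
    rw [← IsGalois.fixedField_fixingSubgroup E, hE, IntermediateField.fixedField_bot]
    exact IntermediateField.mem_top
  exact hx

end IsKummerExtension

end Kummer

section Eisenstein

variable {k : Type*} [Field k] [NumberField k] [IsCyclotomicExtension {3} ℚ k]

theorem prime_two_mul_zeta_add_one {ζ : 𝓞 k} (hζ : IsPrimitiveRoot ζ 3) : Prime (2 * ζ + 1) := by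
  have : Fact (Nat.Prime 3) := ⟨Nat.prime_three⟩
  have hζk : IsPrimitiveRoot (ζ : k) 3 := hζ.map_of_injective RingOfIntegers.coe_injective
  exact (associated_sub_one_two_mul_add_one hζ hζ.pow_eq_one
    (hζ.ne_one (by norm_num))).prime_iff.1 hζk.zeta_sub_one_prime'

theorem pow_six_eq_one (u : (𝓞 k)ˣ) : u ^ 6 = 1 := by
  have hζ := IsCyclotomicExtension.zeta_spec 3 ℚ k
  have hη := hζ.toInteger_isPrimitiveRoot.isUnit_unit (by norm_num)
  have hu := IsCyclotomicExtension.Rat.Three.Units.mem hζ u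
  have hη6 := (hη.pow_eq_one_iff_dvd 6).2 (by norm_num)
  have hη12 := (hη.pow_eq_one_iff_dvd 12).2 (by norm_num)
  simp only [List.mem_cons, List.not_mem_nil, or_false] at hu
  rcases hu with rfl | rfl | rfl | rfl | rfl | rfl
  · exact one_pow 6
  · exact (by decide : Even 6).neg_one_pow
  · exact hη6
  · exact ((by decide : Even 6).neg_pow _).trans hη6
  · exact (pow_mul _ 2 6).symm.trans hη12
  · exact ((by decide : Even 6).neg_pow _).trans ((pow_mul _ 2 6).symm.trans hη12)

theorem exists_unit_eq_mul_cube (u : (𝓞 k)ˣ) : ∃ ω s : (𝓞 k)ˣ, ω ^ 3 = 1 ∧ u = ω * s ^ 3 := by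
  refine ⟨u ^ 4, u⁻¹, ?_, ?_⟩
  · rw [← pow_mul, show 4 * 3 = 6 * 2 from rfl, pow_mul, pow_six_eq_one, one_pow]
  · rw [inv_pow, pow_succ' u 3, mul_inv_cancel_right]

end Eisenstein

section PrimeElement

variable {R : Type*} [CommRing R] [IsDedekindDomain R] (v : HeightOneSpectrum R) {p : R}

theorem asIdeal_eq_span_of_prime_mem (hp : Prime p) (h : p ∈ v.asIdeal) :
    v.asIdeal = Ideal.span {p} := by
  have : (Ideal.span {p}).IsPrime := (Ideal.span_singleton_prime hp.ne_zero).2 hp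
  have hmax : (Ideal.span {p}).IsMaximal := this.isMaximal (by simpa using hp.ne_zero)
  exact (hmax.eq_of_le v.isPrime.ne_top ((Ideal.span_singleton_le_iff_mem _).2 h)).symm

theorem primeOrd_self_of_prime {K : Type*} [Field K] [Algebra R K] [IsFractionRing R K]
    (hp : Prime p) (h : p ∈ v.asIdeal) : primeOrd v (algebraMap R K p) = 1 := by
  rw [← count_spanSingleton_eq_primeOrd v (by simpa using hp.ne_zero),
    ← FractionalIdeal.coeIdeal_span_singleton, ← asIdeal_eq_span_of_prime_mem v hp h]
  exact FractionalIdeal.count_self K v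

theorem exists_algebraMap_mem_of_prime {S : Type*} [CommRing S] [IsDedekindDomain S] [Algebra R S]
    [FaithfulSMul R S] [Algebra.IsIntegral R S] (hp : Prime p) :
    ∃ w : HeightOneSpectrum S, algebraMap R S p ∈ w.asIdeal := by
  have hspan : (Ideal.span {p}).IsPrime := (Ideal.span_singleton_prime hp.ne_zero).2 hp
  obtain ⟨w, hw⟩ := exists_under_eq (S := S) ⟨Ideal.span {p}, hspan, by simpa using hp.ne_zero⟩
  have hpw : p ∈ (w.under R).asIdeal := hw ▸ Ideal.mem_span_singleton_self p
  exact ⟨w, hpw⟩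

theorem algebraMap_notMem_of_prime {S : Type*} [CommRing S] [IsDedekindDomain S] [Algebra R S]
    [Algebra.IsIntegral R S] {w : HeightOneSpectrum S} {q : R} (hp : Prime p) (hpq : ¬ p ∣ q)
    (hw : algebraMap R S p ∈ w.asIdeal) : algebraMap R S q ∉ w.asIdeal := by
  intro hq
  have hq' : q ∈ (w.under R).asIdeal := hq
  rw [asIdeal_eq_span_of_prime_mem _ hp hw, Ideal.mem_span_singleton] at hq'
  exact hpq hq'

end PrimeElement

/-- `K = k(ρ)` with `ρ ^ 3 = π` for a prime element `π ≡ 1 mod 3√-3`, and `τ ρ = ζ ρ`. -/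
structure IsPrimaryCubicExtension {k K : Type*} [Field k] [NumberField k] [Field K]
    [NumberField K] [Algebra k K] (ζ π : 𝓞 k) (ρ : K) (τ : K ≃ₐ[k] K) : Prop where
  zeta : IsPrimitiveRoot ζ 3
  prime : Prime π
  primary : threeSqrtNegThree ζ ∣ π - 1
  cube : ρ ^ 3 = algebraMap (𝓞 k) K π
  adjoin_eq_top : k⟮ρ⟯ = ⊤
  apply_root : τ ρ = algebraMap (𝓞 k) K ζ * ρ

namespace IsPrimaryCubicExtension

variable {k K : Type*} [Field k] [NumberField k] [Field K] [NumberField K] [Algebra k K]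
  {ζ π : 𝓞 k} {ρ : K} {τ : K ≃ₐ[k] K} (h : IsPrimaryCubicExtension ζ π ρ τ)
include h

theorem isKummerExtension : IsKummerExtension 3 (ζ : k) (π : k) ρ τ where
  zeta := h.zeta.map_of_injective RingOfIntegers.coe_injective
  root_ne_zero := by
    rintro rfl
    exact h.prime.ne_zero (by simpa using h.cube.symm)
  root_pow := h.cube
  adjoin_eq_top := h.adjoin_eq_top
  apply_root := h.apply_root

theorem isGalois : IsGalois k K := h.isKummerExtension.isGalois

theorem tau_tau_tau (x : K) : τ (τ (τ x)) = x := by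
  have hτ : τ ^ 3 = 1 := h.isKummerExtension.orderOf_eq ▸ pow_orderOf_eq_one τ
  exact DFunLike.congr_fun hτ x

theorem norm_eq (x : K) : algebraMap k K (Algebra.norm k x) = x * τ x * τ (τ x) := by
  simp [h.isKummerExtension.norm_eq_prod, Finset.prod_range_succ]

theorem primeOrd_algebraMap_eq {w : HeightOneSpectrum (𝓞 K)}
    (hw : algebraMap (𝓞 k) (𝓞 K) π ∉ w.asIdeal) (x : k) :
    primeOrd w (algebraMap k K x) = primeOrd (w.under (𝓞 k)) x := by
  have := h.isGalois
  have hinertia : w.asIdeal.inertia (K ≃ₐ[k] K) = ⊥ := eq_bot_iff.2 fun σ hσ ↦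
    h.isKummerExtension.ext_root (apply_eq_of_mem_inertia_of_cube_eq hσ h.zeta h.primary h.cube hw)
  rw [primeOrd_algebraMap (R := 𝓞 k) w, ← card_inertia_eq_ramificationIdx (F := k), hinertia,
    Subgroup.card_bot, Nat.cast_one, one_mul]

theorem primeOrd_prime {w : HeightOneSpectrum (𝓞 K)} {p : 𝓞 k} (hp : Prime p) (hpπ : ¬ p ∣ π)
    (hw : algebraMap (𝓞 k) (𝓞 K) p ∈ w.asIdeal) : primeOrd w (algebraMap (𝓞 k) K p) = 1 := by
  rw [IsScalarTower.algebraMap_apply (𝓞 k) k K,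
    h.primeOrd_algebraMap_eq (algebraMap_notMem_of_prime hp hpπ hw)]
  exact primeOrd_self_of_prime _ hp hw

variable [IsCyclotomicExtension {3} ℚ k]

theorem not_two_mul_zeta_add_one_dvd : ¬ 2 * ζ + 1 ∣ π := fun hd ↦ by
  have hd1 : 2 * ζ + 1 ∣ π - 1 := (Dvd.intro_left 3 rfl).trans h.primary
  exact (prime_two_mul_zeta_add_one h.zeta).not_isUnit
    (isUnit_of_dvd_one (by simpa using dvd_sub hd hd1))

/-- The ring of integers of `k` is principal with units `ω s³`, and the primes other than `π` are
unramified in `K`, so only a power of `π = ρ³` stands between `b` and a cube. -/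
theorem exists_eq_root_of_unity_mul_cube {b : k} (hb : b ≠ 0)
    (hw : ∀ w : HeightOneSpectrum (𝓞 K), 3 ∣ primeOrd w (algebraMap k K b)) :
    ∃ (ω : 𝓞 k) (c : K), ω ^ 3 = 1 ∧ algebraMap k K b = algebraMap (𝓞 k) K ω * c ^ 3 := by
  have hpid : IsPrincipalIdealRing (𝓞 k) := IsCyclotomicExtension.Rat.three_pid k
  have hπ0 : (π : k) ≠ 0 := by simpa using h.prime.ne_zero
  let v₀ : HeightOneSpectrum (𝓞 k) := ⟨Ideal.span {π},
    (Ideal.span_singleton_prime h.prime.ne_zero).2 h.prime, by simpa using h.prime.ne_zero⟩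
  let m := primeOrd v₀ b
  have hdvd (v : HeightOneSpectrum (𝓞 k)) : (3 : ℤ) ∣ primeOrd v (b / (π : k) ^ m) := by
    rw [primeOrd_div v hb (zpow_ne_zero m hπ0), primeOrd_zpow]
    by_cases hv : π ∈ v.asIdeal
    · have hvv₀ : v = v₀ := HeightOneSpectrum.ext (asIdeal_eq_span_of_prime_mem v h.prime hv)
      rw [show primeOrd v (π : k) = 1 from primeOrd_self_of_prime v h.prime hv, hvv₀, mul_one,
        sub_self]
      exact dvd_zero 3
    · obtain ⟨w, rfl⟩ := exists_under_eq (S := 𝓞 K) v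
      rw [(primeOrd_algebraMap_eq_zero_iff (K := k) _ h.prime.ne_zero).2 hv, mul_zero, sub_zero,
        ← h.primeOrd_algebraMap_eq hv]
      exact hw w
  obtain ⟨u, c, hc⟩ := exists_eq_unit_mul_pow (div_ne_zero hb (zpow_ne_zero m hπ0)) 3 hdvd
  obtain ⟨ω, s, hω, rfl⟩ := exists_unit_eq_mul_cube u
  have hρ : algebraMap k K (π : k) = ρ ^ 3 := h.cube.symm
  refine ⟨ω, algebraMap (𝓞 k) K s * algebraMap k K c * ρ ^ m,
    by rw [← Units.val_pow_eq_pow_val, hω, Units.val_one], ?_⟩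
  calc algebraMap k K b
      = algebraMap k K (algebraMap (𝓞 k) k (ω * s ^ 3 : (𝓞 k)ˣ) * c ^ 3) * (ρ ^ 3) ^ m := by
        rw [← hρ, ← map_zpow₀, ← map_mul, ← hc, div_mul_cancel₀ _ (zpow_ne_zero m hπ0)]
    _ = algebraMap (𝓞 k) K ω * (algebraMap (𝓞 k) K s * algebraMap k K c * ρ ^ m) ^ 3 := by
        rw [map_mul, ← IsScalarTower.algebraMap_apply, ← zpow_natCast ρ, zpow_comm]
        push_cast [map_mul, map_pow]
        simp only [zpow_ofNat]
        ring

end IsPrimaryCubicExtension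

section CubicResidue

theorem exists_pow_eq_of_pow_card_div_eq_one {G : Type*} [CommGroup G] [IsCyclic G] [Finite G]
    {n : ℕ} (hn : n ∣ Nat.card G) {x : G} (hx : x ^ (Nat.card G / n) = 1) : ∃ y, y ^ n = x := by
  have hle : (powMonoidHom n : G →* G).range ≤ (powMonoidHom (Nat.card G / n)).ker := by
    rintro _ ⟨y, rfl⟩
    rw [MonoidHom.mem_ker, powMonoidHom_apply, powMonoidHom_apply, ← pow_mul,
      Nat.mul_div_cancel' hn, pow_card_eq_one']
  have hcard : Nat.card (powMonoidHom (Nat.card G / n) : G →* G).ker ≤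
      Nat.card (powMonoidHom n : G →* G).range := by
    rw [IsCyclic.card_powMonoidHom_range, IsCyclic.card_powMonoidHom_ker,
      Nat.gcd_eq_right hn, Nat.gcd_eq_right (Nat.div_dvd_of_dvd hn)]
  exact (Subgroup.eq_of_le_of_card_ge hle hcard).ge hx

theorem IsCubicResidueSymbol.exists_sub_cube_mem {k : Type*} [Field k] [NumberField k]
    {𝔭 : Ideal (𝓞 k)} [h𝔭 : 𝔭.IsMaximal] (hN : Ideal.absNorm 𝔭 ≡ 1 [MOD 3]) {a : 𝓞 k}
    (ha : a ∉ 𝔭) (h : IsCubicResidueSymbol a 𝔭 1) : ∃ b : 𝓞 k, a - b ^ 3 ∈ 𝔭 := by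
  have h0 : Ideal.absNorm 𝔭 ≠ 0 := fun h0 ↦ absurd (h0 ▸ hN) (by decide)
  have hbot : 𝔭 ≠ ⊥ := fun hbot ↦ h0 (Ideal.absNorm_eq_zero_iff.2 hbot)
  let := Ideal.Quotient.field 𝔭
  have : Finite (𝓞 k ⧸ 𝔭) := Ideal.finiteQuotientOfFreeOfNeBot 𝔭 hbot
  have hcard : Nat.card (𝓞 k ⧸ 𝔭)ˣ = Ideal.absNorm 𝔭 - 1 := by
    rw [Nat.card_units, Ideal.absNorm_apply, Submodule.cardQuot_apply]
  have ha' : Ideal.Quotient.mk 𝔭 a ≠ 0 := by rwa [Ne, Ideal.Quotient.eq_zero_iff_mem]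
  have hpow : Units.mk0 _ ha' ^ (Nat.card (𝓞 k ⧸ 𝔭)ˣ / 3) = 1 := by
    refine Units.ext ?_
    rw [hcard, Units.val_pow_eq_pow_val, Units.val_mk0, Units.val_one, ← map_pow,
      ← map_one (Ideal.Quotient.mk 𝔭), Ideal.Quotient.eq]
    exact h.2
  obtain ⟨y, hy⟩ := exists_pow_eq_of_pow_card_div_eq_one
    (hcard ▸ (Nat.modEq_iff_dvd' (Nat.one_le_iff_ne_zero.2 h0)).1 hN.symm) hpow
  obtain ⟨b, hb⟩ := Ideal.Quotient.mk_surjective (y : 𝓞 k ⧸ 𝔭)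
  refine ⟨b, Ideal.Quotient.eq.1 ?_⟩
  rw [map_pow, hb, ← Units.val_pow_eq_pow_val, hy, Units.val_mk0]

theorem exists_sub_pow_mul_mem_of_cube_sub_cube_mem {A : Type*} [CommRing A] {P : Ideal A}
    [P.IsPrime] {z x y : A} (hz : z ^ 2 + z + 1 = 0) (h : x ^ 3 - y ^ 3 ∈ P) :
    ∃ i : ℕ, x - z ^ i * y ∈ P := by
  have hfactor : x ^ 3 - y ^ 3 = (x - z ^ 0 * y) * ((x - z ^ 1 * y) * (x - z ^ 2 * y)) := by
    linear_combination (x ^ 2 * y - x * y ^ 2 * z + y ^ 3 * (z - 1)) * hz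
  rw [hfactor] at h
  rcases Ideal.IsPrime.mem_or_mem ‹_› h with h | h
  · exact ⟨0, h⟩
  · rcases Ideal.IsPrime.mem_or_mem ‹_› h with h | h
    exacts [⟨1, h⟩, ⟨2, h⟩]

end CubicResidue

theorem eq_one_of_threeSqrtNegThree_dvd {A : Type*} [CommRing A] [IsDedekindDomain A]
    {w : HeightOneSpectrum A} {z ω a b : A} (hz : IsPrimitiveRoot z 3) (hω : ω ^ 3 = 1)
    (hw : 2 * z + 1 ∈ w.asIdeal) (hw2 : 2 * z + 1 ∉ w.asIdeal ^ 2) (hb : b ∉ w.asIdeal)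
    (h : 3 * (2 * z + 1) ∣ a ^ 3 - ω * b ^ 3) : ω = 1 := by
  by_contra hω1
  obtain ⟨u, hu⟩ := (associated_sub_one_two_mul_add_one hz hω hω1).symm
  obtain ⟨c, hc⟩ := h
  have hl2 := sq_two_mul_add_one hz
  generalize 2 * z + 1 = l at hu hc hl2 hw hw2
  have hcube : (a - b) ^ 3 = l * (u * b ^ 3 - l ^ 2 * c + l * a * b * (a - b)) := by
    linear_combination hc - b ^ 3 * hu + (l * c - a * b * (a - b)) * hl2
  have hab : a - b ∈ w.asIdeal :=
    w.isPrime.mem_of_pow_mem 3 (hcube ▸ w.asIdeal.mul_mem_right _ hw)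
  have hmem : l * (u * b ^ 3) ∈ w.asIdeal ^ 2 := by
    have : l * (u * b ^ 3) = (a - b) ^ 2 * (a - b) + l ^ 2 * (l * c - a * b * (a - b)) := by
      linear_combination -hcube
    rw [this]
    exact Ideal.add_mem _ (Ideal.mul_mem_right _ _ (Ideal.pow_mem_pow hab 2))
      (Ideal.mul_mem_right _ _ (Ideal.pow_mem_pow hw 2))
  have hub : (u : A) * b ^ 3 ∉ w.asIdeal := fun hm ↦
    hb (w.isPrime.mem_of_pow_mem 3 ((w.asIdeal.unit_mul_mem_iff_mem u.isUnit).1 hm))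
  rw [mul_comm] at hmem
  exact (w.isPrime.mul_mem_pow _ hmem).elim hub hw2

theorem eq_one_of_congr_cubes {A K : Type*} [CommRing A] [IsDedekindDomain A] [Field K]
    [Algebra A K] [IsFractionRing A K] {w : HeightOneSpectrum A} {z ω α β a b : A} {y : K}
    (hz : IsPrimitiveRoot z 3) (hω : ω ^ 3 = 1) (hw : 2 * z + 1 ∈ w.asIdeal)
    (hw2 : 2 * z + 1 ∉ w.asIdeal ^ 2) (hα : α ∉ w.asIdeal) (hβ : β ∉ w.asIdeal)
    (ha : 3 * (2 * z + 1) ∣ a ^ 3 - α) (hb : 3 * (2 * z + 1) ∣ b ^ 3 - β)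
    (h : algebraMap A K α = algebraMap A K (ω * β) * y ^ 3) : ω = 1 := by
  have hωβ : ω * β ∉ w.asIdeal := by
    rwa [Ideal.unit_mul_mem_iff_mem _ (IsUnit.of_pow_eq_one hω three_ne_zero)]
  have hy : w.valuation K y = 1 := by
    have hval := congrArg (w.valuation K) h
    rw [map_mul, map_pow, (valuation_eq_one_iff_notMem w).2 hα,
      (valuation_eq_one_iff_notMem w).2 hωβ, one_mul] at hval
    exact (pow_eq_one_iff_of_nonneg zero_le three_ne_zero).1 hval.symm
  obtain ⟨N, ⟨d, hd⟩, hNd⟩ := exists_primeCompl_mul_eq_of_integer w y hy.le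
  replace hNd : y * algebraMap A K d = algebraMap A K N := hNd
  have hN : N ∉ w.asIdeal := by
    rw [← w.valuation_eq_one_iff_notMem (K := K), ← hNd, map_mul, hy, one_mul,
      w.valuation_eq_one_iff_notMem]
    exact hd
  have hbw : b ∉ w.asIdeal := fun hbw ↦ hβ <| by
    rw [← sub_sub_cancel (b ^ 3) β]
    exact w.asIdeal.sub_mem (w.asIdeal.pow_mem_of_mem hbw 3 three_pos)
      (w.asIdeal.mem_of_dvd hb (w.asIdeal.mul_mem_left 3 hw))
  have hrel : d ^ 3 * α = ω * β * N ^ 3 := by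
    refine FaithfulSMul.algebraMap_injective A K ?_
    rw [map_mul, map_mul, map_pow, map_pow, h, ← hNd]
    ring
  refine eq_one_of_threeSqrtNegThree_dvd (a := d * a) (b := N * b) hz hω hw hw2
    (fun hm ↦ (w.isPrime.mem_or_mem hm).elim hN hbw) ?_
  have hsplit : (d * a) ^ 3 - ω * (N * b) ^ 3 =
      d ^ 3 * (a ^ 3 - α) - ω * N ^ 3 * (b ^ 3 - β) := by
    linear_combination hrel
  rw [hsplit]
  exact dvd_sub (ha.mul_left _) (hb.mul_left _)

namespace IsPrimaryCubicExtension

open scoped Pointwise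

variable {k K : Type*} [Field k] [NumberField k] [Field K] [NumberField K] [Algebra k K]
  {ζ π : 𝓞 k} {ρ : K} {τ : K ≃ₐ[k] K} (h : IsPrimaryCubicExtension ζ π ρ τ)
include h

theorem smul_ne_self {p b : 𝓞 k} (hp : Prime p) (hpπ : ¬ p ∣ π) (hpζ : ¬ p ∣ 2 * ζ + 1)
    (hb : p ∣ π - b ^ 3) {w : HeightOneSpectrum (𝓞 K)}
    (hw : algebraMap (𝓞 k) (𝓞 K) p ∈ w.asIdeal) : τ • w ≠ w := by
  intro hτw
  let ι := algebraMap (𝓞 k) (𝓞 K)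
  obtain ⟨r, hrρ, hr⟩ := exists_integer_eq_of_pow_eq (a := ι π) three_ne_zero h.cube
  have hτr : τ • r = ι ζ * r := RingOfIntegers.coe_injective <| by
    change τ (r : K) = algebraMap (𝓞 k) K ζ * (r : K)
    rw [hrρ, h.apply_root]
  have hbw : r ^ 3 - ι b ^ 3 ∈ w.asIdeal := by
    rw [hr, ← map_pow, ← map_sub]
    exact w.asIdeal.mem_of_dvd (map_dvd ι hb) hw
  have hz : ι ζ ^ 2 + ι ζ + 1 = 0 := by
    simpa using congrArg ι (sq_add_self_add_one_eq_zero h.zeta)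
  obtain ⟨i, hi⟩ := exists_sub_pow_mul_mem_of_cube_sub_cube_mem hz hbw
  have hτi : ι ζ * r - ι ζ ^ i * ι b ∈ w.asIdeal := by
    have hmem := Ideal.smul_mem_pointwise_smul τ _ w.asIdeal hi
    rw [← asIdeal_smul, hτw, ← map_pow, ← map_mul, smul_sub, hτr, smul_algebraMap_integer,
      map_mul, map_pow] at hmem
    exact hmem
  have hmul : ι (ζ - 1) * r ∈ w.asIdeal := by
    convert w.asIdeal.sub_mem hτi hi using 1
    rw [map_sub, map_one]
    ring
  have hζ1 : ¬ p ∣ ζ - 1 := fun hd ↦ hpζ (hd.trans (associated_sub_one_two_mul_add_one h.zeta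
    h.zeta.pow_eq_one (h.zeta.ne_one (by norm_num))).dvd)
  rcases w.isPrime.mem_or_mem hmul with hmem | hmem
  · exact algebraMap_notMem_of_prime hp hζ1 hw hmem
  · exact algebraMap_notMem_of_prime hp hpπ hw (hr ▸ w.asIdeal.pow_mem_of_mem hmem 3 three_pos)

theorem exists_eq_pow_smul_of_mem {p : 𝓞 k} (hp : Prime p) {v w : HeightOneSpectrum (𝓞 K)}
    (hv : algebraMap (𝓞 k) (𝓞 K) p ∈ v.asIdeal) (hw : algebraMap (𝓞 k) (𝓞 K) p ∈ w.asIdeal) :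
    ∃ i < 3, w = τ ^ i • v := by
  have := h.isGalois
  have hv' : (v.under (𝓞 k)).asIdeal = Ideal.span {p} := asIdeal_eq_span_of_prime_mem _ hp hv
  have hw' : (w.under (𝓞 k)).asIdeal = Ideal.span {p} := asIdeal_eq_span_of_prime_mem _ hp hw
  have : v.asIdeal.LiesOver (Ideal.span {p}) := ⟨hv'.symm⟩
  have : w.asIdeal.LiesOver (Ideal.span {p}) := ⟨hw'.symm⟩
  obtain ⟨g, hg⟩ :=
    Ideal.exists_smul_eq_of_isGaloisGroup (Ideal.span {p}) v.asIdeal w.asIdeal (K ≃ₐ[k] K)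
  classical
  obtain ⟨i, hi, rfl⟩ := Finset.mem_image.1
    (h.isKummerExtension.isOfFinOrder.mem_zpowers_iff_mem_range_orderOf.1
      (h.isKummerExtension.mem_zpowers g))
  rw [Finset.mem_range, h.isKummerExtension.orderOf_eq] at hi
  exact ⟨i, hi, HeightOneSpectrum.ext hg.symm⟩

theorem two_mul_zeta_add_one_notMem_sq [IsCyclotomicExtension {3} ℚ k]
    {w : HeightOneSpectrum (𝓞 K)} (hw : algebraMap (𝓞 k) (𝓞 K) (2 * ζ + 1) ∈ w.asIdeal) :
    algebraMap (𝓞 k) (𝓞 K) (2 * ζ + 1) ∉ w.asIdeal ^ 2 := by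
  have hprime := prime_two_mul_zeta_add_one h.zeta
  have hne : algebraMap (𝓞 k) (𝓞 K) (2 * ζ + 1) ≠ 0 :=
    (map_ne_zero_iff _ (FaithfulSMul.algebraMap_injective _ _)).2 hprime.ne_zero
  rw [mem_asIdeal_pow_iff_le_primeOrd (K := K) w hne, ← IsScalarTower.algebraMap_apply,
    h.primeOrd_prime hprime h.not_two_mul_zeta_add_one_dvd hw]
  norm_num

end IsPrimaryCubicExtension

/-- `π₁` is a cube modulo a second primary prime `π₂` of `k`, `P` is a prime of `K = k(ρ)` over
`π₂`, and `θ` is an admissible integer of `K` relative to `P`. -/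
structure IsAdmissibleDatum {k K : Type*} [Field k] [NumberField k] [Field K]
    [NumberField K] [Algebra k K] (ζ π₁ π₂ : 𝓞 k) (ρ : K) (τ : K ≃ₐ[k] K)
    (P : HeightOneSpectrum (𝓞 K)) (θ : 𝓞 K) : Prop extends
    IsPrimaryCubicExtension ζ π₁ ρ τ where
  prime₂ : Prime π₂
  primary₂ : threeSqrtNegThree ζ ∣ π₂ - 1
  not_dvd : ¬ π₂ ∣ π₁
  cube_residue : ∃ b, π₂ ∣ π₁ - b ^ 3
  mem : algebraMap (𝓞 k) (𝓞 K) π₂ ∈ P.asIdeal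
  admissible : IsAdmissible ζ π₂ τ P.asIdeal θ

theorem algebraMap_mem_smul_iff {k K : Type*} [Field k] [Field K] [Algebra k K] (σ : K ≃ₐ[k] K)
    {w : HeightOneSpectrum (𝓞 K)} {x : 𝓞 k} :
    algebraMap (𝓞 k) (𝓞 K) x ∈ (σ • w).asIdeal ↔ algebraMap (𝓞 k) (𝓞 K) x ∈ w.asIdeal := by
  open scoped Pointwise in
  conv_lhs => rw [← smul_algebraMap_integer σ, asIdeal_smul, Ideal.smul_mem_pointwise_smul_iff]

theorem IsPrimaryCubicExtension.exists_apply_eq_mul_cube {k K : Type*} [Field k] [NumberField k]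
    [Field K] [NumberField K] [Algebra k K] {ζ π : 𝓞 k} {ρ : K} {τ : K ≃ₐ[k] K}
    (h : IsPrimaryCubicExtension ζ π ρ τ) {x : K} (hx : x ≠ 0) {c : k}
    (hc : Algebra.norm k x = c ^ 3) :
    ∃ (b : k) (κ : K), κ ≠ 0 ∧ τ x = algebraMap k K b * x * κ ^ 3 := by
  let C := algebraMap k K c
  have hnorm : C ^ 3 = x * τ x * τ (τ x) := by rw [← h.norm_eq, hc, map_pow]
  have hτx : τ x ≠ 0 := by simpa using hx
  have hC : C ≠ 0 := fun hC ↦ by simp [hC, hx] at hnorm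
  have hτC : τ C = C := τ.commutes c
  have hprod : ∏ i ∈ Finset.range (orderOf τ), (τ ^ i) (τ x / C) = 1 := by
    simp only [h.isKummerExtension.orderOf_eq, Finset.prod_range_succ, Finset.prod_range_zero,
      pow_zero, pow_one, pow_two, AlgEquiv.one_apply, AlgEquiv.mul_apply, map_div₀, hτC,
      h.tau_tau_tau]
    field_simp
    linear_combination -hnorm
  obtain ⟨κ, hκ0, hκ⟩ :=
    exists_eq_mul_apply_of_prod_eq_one h.isKummerExtension.isOfFinOrder hprod
  have hτκ : τ κ = C / τ x * κ := by
    nth_rw 2 [hκ]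
    field_simp
  have hfix : τ (τ x / x / κ ^ 3) = τ x / x / κ ^ 3 := by
    rw [map_div₀, map_div₀, map_pow, hτκ]
    field_simp
    linear_combination -hnorm
  obtain ⟨b, hb⟩ := h.isKummerExtension.exists_algebraMap_eq_of_apply_eq hfix
  refine ⟨b, κ, hκ0, ?_⟩
  rw [hb]
  field_simp

namespace IsAdmissibleDatum

variable {k K : Type*} [Field k] [NumberField k] [Field K] [NumberField K] [Algebra k K]
  {ζ π₁ π₂ : 𝓞 k} {ρ : K} {τ : K ≃ₐ[k] K} {P : HeightOneSpectrum (𝓞 K)} {θ : 𝓞 K}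
  (h : IsAdmissibleDatum ζ π₁ π₂ ρ τ P θ)
include h

theorem pi_two_ne_zero : algebraMap (𝓞 k) K π₂ ≠ 0 := by
  simpa using h.prime₂.ne_zero

theorem primeOrd_pi_two {w : HeightOneSpectrum (𝓞 K)}
    (hw : algebraMap (𝓞 k) (𝓞 K) π₂ ∈ w.asIdeal) : primeOrd w (algebraMap (𝓞 k) K π₂) = 1 :=
  h.primeOrd_prime h.prime₂ h.not_dvd hw

theorem primeOrd_pi_two_eq_zero {w : HeightOneSpectrum (𝓞 K)}
    (hw : algebraMap (𝓞 k) (𝓞 K) π₂ ∉ w.asIdeal) : primeOrd w (algebraMap (𝓞 k) K π₂) = 0 :=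
  (primeOrd_algebraMap_eq_zero_iff (K := K) w
    ((map_ne_zero_iff _ (FaithfulSMul.algebraMap_injective _ _)).2 h.prime₂.ne_zero)).2 hw

theorem not_dvd_two_mul_zeta_add_one : ¬ π₂ ∣ 2 * ζ + 1 := fun hd ↦ by
  have hd1 : π₂ ∣ π₂ - 1 := hd.trans ((Dvd.intro_left 3 rfl).trans h.primary₂)
  exact h.prime₂.not_isUnit (isUnit_of_dvd_one (by simpa using dvd_sub (dvd_refl π₂) hd1))

theorem notMem_of_two_mul_zeta_add_one_mem {w : HeightOneSpectrum (𝓞 K)}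
    (hw : algebraMap (𝓞 k) (𝓞 K) (2 * ζ + 1) ∈ w.asIdeal) :
    algebraMap (𝓞 k) (𝓞 K) π₂ ∉ w.asIdeal := fun hm ↦
  algebraMap_notMem_of_prime h.prime₂ h.not_dvd_two_mul_zeta_add_one hm hw

theorem smul_ne_self {w : HeightOneSpectrum (𝓞 K)}
    (hw : algebraMap (𝓞 k) (𝓞 K) π₂ ∈ w.asIdeal) : τ • w ≠ w :=
  have ⟨_, hb⟩ := h.cube_residue
  h.toIsPrimaryCubicExtension.smul_ne_self h.prime₂ h.not_dvd h.not_dvd_two_mul_zeta_add_one hb hw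

theorem not_le_asIdeal_of_isCoprime {A : Ideal (𝓞 K)} (hA : IsCoprime A (Ideal.span {3}))
    {w : HeightOneSpectrum (𝓞 K)} (hw : algebraMap (𝓞 k) (𝓞 K) (2 * ζ + 1) ∈ w.asIdeal) :
    ¬ A ≤ w.asIdeal := fun hle ↦ by
  have h3 : (3 : 𝓞 K) ∈ w.asIdeal := by
    have hsq := congrArg (algebraMap (𝓞 k) (𝓞 K)) (sq_two_mul_add_one h.zeta)
    rw [map_pow, map_neg, map_ofNat] at hsq
    exact w.asIdeal.neg_mem_iff.1 (hsq ▸ w.asIdeal.pow_mem_of_mem hw 2 two_pos)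
  exact w.isPrime.ne_top (top_le_iff.1
    (Ideal.isCoprime_iff_sup_eq.1 hA ▸ sup_le hle ((Ideal.span_singleton_le_iff_mem _).2 h3)))

variable [IsCyclotomicExtension {3} ℚ k]

theorem exists_primeOrd_theta_eq : algebraMap (𝓞 K) K θ ≠ 0 ∧
    ∃ (e m : ℤ) (A : Ideal (𝓞 K)), IsCoprime e 3 ∧ A ≠ 0 ∧ IsCoprime A (Ideal.span {3}) ∧
      ∀ w : HeightOneSpectrum (𝓞 K), primeOrd w (algebraMap (𝓞 K) K θ) =
        2 * e * FractionalIdeal.count K w (P.asIdeal : FractionalIdeal (𝓞 K)⁰ K) +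
        e * FractionalIdeal.count K w ((τ • P).asIdeal : FractionalIdeal (𝓞 K)⁰ K) +
        3 * m * FractionalIdeal.count K w (A : FractionalIdeal (𝓞 K)⁰ K) := by
  obtain ⟨e, _, A, he, hA, ⟨m, rfl⟩, hfac⟩ := h.admissible.factorization
  change FractionalIdeal.spanSingleton (𝓞 K)⁰ (algebraMap (𝓞 K) K θ) =
    (P.asIdeal : FractionalIdeal (𝓞 K)⁰ K) ^ (2 * e) *
      ((τ • P).asIdeal : FractionalIdeal (𝓞 K)⁰ K) ^ e *
      (A : FractionalIdeal (𝓞 K)⁰ K) ^ (3 * m) at hfac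
  have hA0 : A ≠ 0 := by
    rintro rfl
    obtain ⟨w, hw⟩ :=
      exists_algebraMap_mem_of_prime (S := 𝓞 K) (prime_two_mul_zeta_add_one h.zeta)
    exact h.not_le_asIdeal_of_isCoprime hA hw bot_le
  have hPe := zpow_ne_zero (2 * e) (FractionalIdeal.coeIdeal_ne_zero (K := K).2 P.ne_bot)
  have hQe := zpow_ne_zero e (FractionalIdeal.coeIdeal_ne_zero (K := K).2 (τ • P).ne_bot)
  have hAm := zpow_ne_zero (3 * m) (FractionalIdeal.coeIdeal_ne_zero (K := K).2 hA0)
  have hθ : algebraMap (𝓞 K) K θ ≠ 0 := by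
    rw [← FractionalIdeal.spanSingleton_ne_zero_iff (S := (𝓞 K)⁰), hfac]
    exact mul_ne_zero (mul_ne_zero hPe hQe) hAm
  refine ⟨hθ, e, m, A, he, hA0, hA, fun w ↦ ?_⟩
  rw [← count_spanSingleton_eq_primeOrd w hθ, hfac,
    FractionalIdeal.count_mul K w (mul_ne_zero hPe hQe) hAm, FractionalIdeal.count_mul K w hPe hQe,
    FractionalIdeal.count_zpow, FractionalIdeal.count_zpow, FractionalIdeal.count_zpow]

theorem theta_ne_zero : algebraMap (𝓞 K) K θ ≠ 0 := h.exists_primeOrd_theta_eq.1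

theorem theta_notMem {w : HeightOneSpectrum (𝓞 K)}
    (hw : algebraMap (𝓞 k) (𝓞 K) (2 * ζ + 1) ∈ w.asIdeal) : θ ∉ w.asIdeal := by
  classical
  obtain ⟨hθ, e, m, A, -, hA0, hA, hord⟩ := h.exists_primeOrd_theta_eq
  have hP : P ≠ w := fun hP ↦ h.notMem_of_two_mul_zeta_add_one_mem hw (hP ▸ h.mem)
  have hQ : τ • P ≠ w := fun hQ ↦
    h.notMem_of_two_mul_zeta_add_one_mem hw (hQ ▸ (algebraMap_mem_smul_iff τ).2 h.mem)
  have hA : FractionalIdeal.count K w (A : FractionalIdeal (𝓞 K)⁰ K) = 0 := by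
    rw [FractionalIdeal.count_coe K w hA0, Nat.cast_eq_zero]
    by_contra hcount
    exact h.not_le_asIdeal_of_isCoprime hA hw
      (Ideal.le_of_dvd ((Associates.count_ne_zero_iff_dvd hA0 w.irreducible).1 hcount))
  rw [← primeOrd_algebraMap_eq_zero_iff (K := K) w (by simpa using hθ), hord w, hA,
    FractionalIdeal.count_maximal, FractionalIdeal.count_maximal, if_neg hP, if_neg hQ]
  ring

/-- The exponent `n` is the exponent `e` of the factorization of `θ`, reduced modulo `3`. -/
theorem exists_primeOrd_theta : ∃ n : ℕ, ¬ 3 ∣ n ∧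
    (∀ w, w ≠ P → w ≠ τ • P → 3 ∣ primeOrd w (algebraMap (𝓞 K) K θ)) ∧
    3 ∣ primeOrd P (algebraMap (𝓞 K) K θ) - 2 * n ∧
    3 ∣ primeOrd (τ • P) (algebraMap (𝓞 K) K θ) - n := by
  classical
  obtain ⟨-, e, m, A, ⟨a, b, hab⟩, -, -, hord⟩ := h.exists_primeOrd_theta_eq
  have hP := h.smul_ne_self h.mem
  have he : ¬ (3 : ℤ) ∣ e := fun hd ↦ by
    have h1 : (3 : ℤ) ∣ 1 := hab ▸ dvd_add (hd.mul_left a) (dvd_mul_left 3 b)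
    omega
  simp only [FractionalIdeal.count_maximal, mul_assoc] at hord
  refine ⟨(e % 3).toNat, by omega, fun w hw hw' ↦ ?_, ?_, ?_⟩
  · rw [hord w, if_neg hw.symm, if_neg hw'.symm]
    omega
  · rw [hord P, if_pos rfl, if_neg hP]
    omega
  · rw [hord (τ • P), if_neg hP.symm, if_pos rfl]
    omega

theorem three_dvd_primeOrd_theta {w : HeightOneSpectrum (𝓞 K)}
    (hw : algebraMap (𝓞 k) (𝓞 K) π₂ ∉ w.asIdeal) : 3 ∣ primeOrd w (algebraMap (𝓞 K) K θ) := by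
  obtain ⟨n, -, hord, -, -⟩ := h.exists_primeOrd_theta
  refine hord w ?_ ?_
  · rintro rfl
    exact hw h.mem
  · rintro rfl
    exact hw ((algebraMap_mem_smul_iff τ).2 h.mem)

theorem exists_three_dvd_primeOrd_apply_theta : ∃ n : ℕ, ¬ 3 ∣ n ∧
    ∀ w : HeightOneSpectrum (𝓞 K), 3 ∣ primeOrd w (τ (algebraMap (𝓞 K) K θ)) -
      primeOrd w (algebraMap (𝓞 K) K θ) - n * primeOrd w (algebraMap (𝓞 k) K π₂) := by
  obtain ⟨n, hn, hord, hordP, hordQ⟩ := h.exists_primeOrd_theta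
  refine ⟨n, hn, fun w ↦ ?_⟩
  have hτ3 (v : HeightOneSpectrum (𝓞 K)) : τ • τ • τ • v = v := by
    have hτ : τ ^ 3 = 1 := h.isKummerExtension.orderOf_eq ▸ pow_orderOf_eq_one τ
    rw [smul_smul, smul_smul, ← pow_two, ← pow_succ, hτ, one_smul]
  have hτθ : primeOrd w (τ (algebraMap (𝓞 K) K θ)) =
      primeOrd (τ • τ • w) (algebraMap (𝓞 K) K θ) := by
    rw [← primeOrd_smul τ (τ • τ • w), hτ3]
    rfl
  by_cases hw : algebraMap (𝓞 k) (𝓞 K) π₂ ∈ w.asIdeal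
  · have hP := h.smul_ne_self h.mem
    have hQ := h.smul_ne_self ((algebraMap_mem_smul_iff τ).2 h.mem)
    have hR : τ • τ • P ≠ P := fun hR ↦ hP <| by
      conv_lhs => rw [← hR, hτ3]
    have hordR := hord _ hR hQ
    obtain ⟨i, hi, rfl⟩ := h.exists_eq_pow_smul_of_mem h.prime₂ h.mem hw
    rw [h.primeOrd_pi_two hw, hτθ]
    interval_cases i
    · rw [pow_zero, one_smul]
      omega
    · rw [pow_one, hτ3]
      omega
    · rw [pow_two, mul_smul, hτ3]
      omega
  · have hw' : algebraMap (𝓞 k) (𝓞 K) π₂ ∉ (τ • τ • w).asIdeal := by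
      rwa [algebraMap_mem_smul_iff, algebraMap_mem_smul_iff]
    rw [h.primeOrd_pi_two_eq_zero hw, hτθ, mul_zero, sub_zero]
    exact dvd_sub (h.three_dvd_primeOrd_theta hw') (h.three_dvd_primeOrd_theta hw)

theorem apply_theta_ne : τ (algebraMap (𝓞 K) K θ) ≠ algebraMap (𝓞 K) K θ := fun heq ↦ by
  obtain ⟨n, hn, hord⟩ := h.exists_three_dvd_primeOrd_apply_theta
  have hP := hord P
  rw [heq, h.primeOrd_pi_two h.mem] at hP
  omega

open scoped Pointwise in
theorem smul_theta_notMem {w : HeightOneSpectrum (𝓞 K)}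
    (hw : algebraMap (𝓞 k) (𝓞 K) (2 * ζ + 1) ∈ w.asIdeal) : τ • θ ∉ w.asIdeal := by
  rw [← Ideal.mem_inv_pointwise_smul_iff, ← asIdeal_smul]
  exact h.theta_notMem ((algebraMap_mem_smul_iff τ⁻¹).2 hw)

theorem root_of_unity_eq_one {ω : 𝓞 K} (hω : ω ^ 3 = 1) {n : ℕ} {y : K}
    (hy : τ (algebraMap (𝓞 K) K θ) =
      algebraMap (𝓞 K) K (ω * (θ * algebraMap (𝓞 k) (𝓞 K) π₂ ^ n)) * y ^ 3) : ω = 1 := by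
  obtain ⟨w, hw⟩ :=
    exists_algebraMap_mem_of_prime (S := 𝓞 K) (prime_two_mul_zeta_add_one h.zeta)
  obtain ⟨η, hη⟩ := h.admissible.cube_congr
  rw [Ideal.mem_span_singleton] at hη
  let D := algebraMap (𝓞 k) (𝓞 K) (threeSqrtNegThree ζ)
  have hτη : D ∣ (τ • η) ^ 3 - τ • θ := by
    obtain ⟨c, hc⟩ := hη
    refine ⟨τ • c, ?_⟩
    rw [← smul_pow', ← smul_sub, hc, smul_mul', smul_algebraMap_integer]
  have hπD : D ∣ algebraMap (𝓞 k) (𝓞 K) π₂ ^ n - 1 := by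
    have hπ := map_dvd (algebraMap (𝓞 k) (𝓞 K)) h.primary₂
    rw [map_sub, map_one] at hπ
    exact hπ.trans (sub_one_dvd_pow_sub_one _ n)
  have hηπ : D ∣ η ^ 3 - θ * algebraMap (𝓞 k) (𝓞 K) π₂ ^ n := by
    convert dvd_sub hη (hπD.mul_left θ) using 1
    ring
  have hθπ : θ * algebraMap (𝓞 k) (𝓞 K) π₂ ^ n ∉ w.asIdeal := fun hm ↦
    (w.isPrime.mem_or_mem hm).elim (h.theta_notMem hw) fun hm ↦
      h.notMem_of_two_mul_zeta_add_one_mem hw (w.isPrime.mem_of_pow_mem n hm)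
  have hw2 := h.two_mul_zeta_add_one_notMem_sq hw
  have hτθ := h.smul_theta_notMem hw
  have hD : D = 3 * (2 * algebraMap (𝓞 k) (𝓞 K) ζ + 1) := algebraMap_threeSqrtNegThree ζ
  rw [hD] at hτη hηπ
  rw [map_add, map_mul, map_one, map_ofNat] at hw hw2
  exact eq_one_of_congr_cubes (h.zeta.map_of_injective (FaithfulSMul.algebraMap_injective _ _))
    hω hw hw2 hτθ hθπ hτη hηπ hy

theorem exists_apply_theta_eq : ∃ (n : ℕ) (x : K), ¬ 3 ∣ n ∧
    τ (algebraMap (𝓞 K) K θ) =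
      algebraMap (𝓞 K) K θ * algebraMap (𝓞 k) K π₂ ^ n * x ^ 3 := by
  obtain ⟨n, hn, hord⟩ := h.exists_three_dvd_primeOrd_apply_theta
  obtain ⟨u, hu⟩ := h.admissible.norm_eq
  have hθ0 := h.theta_ne_zero
  obtain ⟨b, κ, hκ0, hκ⟩ := h.exists_apply_eq_mul_cube hθ0 (hu.trans (mul_pow _ _ _).symm)
  have hπ0 := pow_ne_zero n h.pi_two_ne_zero
  have hb0 : algebraMap k K b ≠ 0 := fun hb ↦ by simp [hb, hθ0] at hκ
  have hbπ : algebraMap k K (b / (π₂ : k) ^ n) =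
      algebraMap k K b / algebraMap (𝓞 k) K π₂ ^ n := by
    rw [map_div₀, map_pow]
    rfl
  have hbπ0 : b / (π₂ : k) ^ n ≠ 0 := by
    rw [← map_ne_zero (algebraMap k K), hbπ]
    exact div_ne_zero hb0 hπ0
  obtain ⟨ω, y, hω, hy⟩ := h.exists_eq_root_of_unity_mul_cube hbπ0 fun w ↦ by
    have hw := hord w
    rw [hκ, primeOrd_mul w (mul_ne_zero hb0 hθ0) (pow_ne_zero 3 hκ0), primeOrd_mul w hb0 hθ0,
      primeOrd_pow] at hw
    rw [hbπ, primeOrd_div w hb0 hπ0, primeOrd_pow]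
    omega
  have hrel : τ (algebraMap (𝓞 K) K θ) = algebraMap (𝓞 k) K ω *
      (algebraMap (𝓞 K) K θ * algebraMap (𝓞 k) K π₂ ^ n) * (y * κ) ^ 3 := by
    rw [hbπ, div_eq_iff hπ0] at hy
    rw [hκ, hy]
    ring
  have hω1 : algebraMap (𝓞 k) (𝓞 K) ω = 1 :=
    h.root_of_unity_eq_one (n := n) (y := y * κ) (by rw [← map_pow, hω, map_one])
      (by rw [hrel, map_mul, map_mul, map_pow]; rfl)
  have hω1' : algebraMap (𝓞 k) K ω = 1 := by
    rw [IsScalarTower.algebraMap_apply (𝓞 k) (𝓞 K) K, hω1, map_one]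
  rw [hω1', one_mul] at hrel
  exact ⟨n, y * κ, hn, hrel⟩

end IsAdmissibleDatum

theorem algebraMap_mem_under_iff {R S T : Type*} [CommRing R] [CommRing S] [IsDedekindDomain S]
    [CommRing T] [IsDedekindDomain T] [Algebra R S] [Algebra R T] [Algebra S T]
    [IsScalarTower R S T] [Algebra.IsIntegral S T] {w : HeightOneSpectrum T}
    {x : R} : algebraMap R S x ∈ (w.under S).asIdeal ↔ algebraMap R T x ∈ w.asIdeal := by
  rw [IsScalarTower.algebraMap_apply R S T]
  rfl

section PrimePower

variable {k L : Type*} [Field k] [NumberField k] [Field L] [NumberField L] [Algebra k L]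
  {π : 𝓞 k} {r : L} {n : ℕ} {w : HeightOneSpectrum (𝓞 L)}

theorem dvd_ramificationIdx_of_prime_eq_pow (hπ : Prime π) (hr : r ^ n = algebraMap (𝓞 k) L π)
    (hw : algebraMap (𝓞 k) (𝓞 L) π ∈ w.asIdeal) : n ∣ w.asIdeal.ramificationIdx (𝓞 k) := by
  have hord : primeOrd w (r ^ n) = w.asIdeal.ramificationIdx (𝓞 k) := by
    rw [hr, IsScalarTower.algebraMap_apply (𝓞 k) k L, primeOrd_algebraMap (R := 𝓞 k),
      primeOrd_self_of_prime (w.under (𝓞 k)) hπ hw, mul_one]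
  rw [primeOrd_pow] at hord
  exact_mod_cast Dvd.intro _ hord

variable [IsGalois k L]

theorem ramificationIdx_eq_of_prime_eq_pow (hn : 0 < n) (hπ : Prime π)
    (hr : r ^ n = algebraMap (𝓞 k) L π) (hw : algebraMap (𝓞 k) (𝓞 L) π ∈ w.asIdeal)
    (hinj : ∀ σ ∈ w.asIdeal.inertia (L ≃ₐ[k] L), σ r = r → σ = 1) :
    w.asIdeal.ramificationIdx (𝓞 k) = n := by
  classical
  have hdvd := dvd_ramificationIdx_of_prime_eq_pow hπ hr hw
  rw [← card_inertia_eq_ramificationIdx] at hdvd ⊢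
  refine le_antisymm ?_ (Nat.le_of_dvd Nat.card_pos hdvd)
  let f (σ : w.asIdeal.inertia (L ≃ₐ[k] L)) :
      (Polynomial.nthRoots n (algebraMap (𝓞 k) L π)).toFinset :=
    ⟨σ.1 r, by
      rw [Multiset.mem_toFinset, Polynomial.mem_nthRoots hn, ← map_pow, hr]
      exact σ.1.commutes _⟩
  have hf : Function.Injective f := fun σ σ' h ↦ by
    have hσ : σ'.1.symm (σ.1 r) = r := by
      rw [show σ.1 r = σ'.1 r from congrArg Subtype.val h, AlgEquiv.symm_apply_apply]
    exact (inv_mul_eq_one.1 (Subtype.ext (hinj _ (σ'⁻¹ * σ).2 hσ))).symm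
  calc Nat.card (w.asIdeal.inertia (L ≃ₐ[k] L))
      ≤ Nat.card (Polynomial.nthRoots n (algebraMap (𝓞 k) L π)).toFinset :=
        Nat.card_le_card_of_injective f hf
    _ ≤ n := by
        rw [Nat.card_eq_fintype_card, Fintype.card_coe]
        exact (Multiset.toFinset_card_le _).trans (Polynomial.card_nthRoots n _)

theorem exists_mem_inertia_apply_ne (h1 : w.asIdeal.ramificationIdx (𝓞 k) ≠ 1)
    (hinj : ∀ σ ∈ w.asIdeal.inertia (L ≃ₐ[k] L), σ r = r → σ = 1) :
    ∃ σ ∈ w.asIdeal.inertia (L ≃ₐ[k] L), σ r ≠ r := by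
  rw [← card_inertia_eq_ramificationIdx, Ne, Subgroup.card_eq_one, ← Ne,
    Subgroup.ne_bot_iff_exists_ne_one] at h1
  obtain ⟨σ, hσ⟩ := h1
  exact ⟨σ, σ.2, fun h ↦ hσ (Subtype.ext (hinj σ σ.2 h))⟩

end PrimePower

/-- The field `L = k(ρ, ρ₂, t)` obtained from `K = k(ρ)` by adjoining cube roots `ρ₂` of `π₂` and
`t` of `θ`. -/
structure IsRedeiExtension {k K L : Type*} [Field k] [NumberField k] [Field K] [NumberField K]
    [Field L] [NumberField L] [Algebra k K] [Algebra k L] [Algebra K L]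
    (ζ π₁ π₂ : 𝓞 k) (ρ : K) (τ : K ≃ₐ[k] K) (P : HeightOneSpectrum (𝓞 K)) (θ : 𝓞 K)
    (ρ₂ t : L) : Prop extends IsAdmissibleDatum ζ π₁ π₂ ρ τ P θ where
  cube₂ : ρ₂ ^ 3 = algebraMap (𝓞 k) L π₂
  cube_theta : t ^ 3 = algebraMap (𝓞 K) L θ
  adjoin_roots_eq_top : IntermediateField.adjoin k {algebraMap K L ρ, ρ₂, t} = ⊤

namespace IsRedeiExtension

variable {k K L : Type*} [Field k] [NumberField k] [Field K] [NumberField K] [Field L]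
  [NumberField L] [Algebra k K] [Algebra k L] [Algebra K L]
  {ζ π₁ π₂ : 𝓞 k} {ρ : K} {τ : K ≃ₐ[k] K} {P : HeightOneSpectrum (𝓞 K)} {θ : 𝓞 K} {ρ₂ t : L}
  (h : IsRedeiExtension ζ π₁ π₂ ρ τ P θ ρ₂ t) {w : HeightOneSpectrum (𝓞 L)} {σ : L ≃ₐ[k] L}
include h

theorem pi_one_notMem (hw : algebraMap (𝓞 k) (𝓞 L) π₂ ∈ w.asIdeal) :
    algebraMap (𝓞 k) (𝓞 L) π₁ ∉ w.asIdeal :=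
  algebraMap_notMem_of_prime h.prime₂ h.not_dvd hw

theorem zeta_top : IsPrimitiveRoot (algebraMap (𝓞 k) (𝓞 L) ζ) 3 :=
  h.zeta.map_of_injective (FaithfulSMul.algebraMap_injective (𝓞 k) (𝓞 L))

theorem root_two_ne_zero : ρ₂ ≠ 0 := by
  rw [← pow_ne_zero_iff three_ne_zero, h.cube₂]
  simpa using h.prime₂.ne_zero

theorem root_theta_ne_zero [IsCyclotomicExtension {3} ℚ k] : t ≠ 0 := by
  rw [← pow_ne_zero_iff three_ne_zero, h.cube_theta]
  simpa using h.theta_ne_zero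

theorem three_mul_primeOrd_root_theta (w : HeightOneSpectrum (𝓞 L)) : 3 * primeOrd w t =
    w.asIdeal.ramificationIdx (𝓞 K) * primeOrd (w.under (𝓞 K)) (algebraMap (𝓞 K) K θ) := by
  rw [← primeOrd_algebraMap (L := L), ← IsScalarTower.algebraMap_apply, ← h.cube_theta,
    primeOrd_pow]
  rfl

variable [IsScalarTower k K L]

theorem cube_one : algebraMap K L ρ ^ 3 = algebraMap (𝓞 k) L π₁ := by
  rw [← map_pow, h.cube]
  exact (IsScalarTower.algebraMap_apply k K L _).symm

theorem apply_algebraMap (hσ : σ (algebraMap K L ρ) = algebraMap K L ρ) (x : K) :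
    σ (algebraMap K L x) = algebraMap K L x :=
  h.isKummerExtension.apply_algebraMap_eq (f := 1) (g := (σ : L →ₐ[k] L)) hσ x

theorem smul_algebraMap (hσ : σ (algebraMap K L ρ) = algebraMap K L ρ) (x : 𝓞 K) :
    σ • algebraMap (𝓞 K) (𝓞 L) x = algebraMap (𝓞 K) (𝓞 L) x :=
  RingOfIntegers.coe_injective (h.apply_algebraMap hσ (algebraMap (𝓞 K) K x))

variable [IsCyclotomicExtension {3} ℚ k]

theorem apply_root_theta_of_two_mul_zeta_add_one_mem
    (hσ : σ ∈ w.asIdeal.inertia (L ≃ₐ[k] L)) (hσρ : σ (algebraMap K L ρ) = algebraMap K L ρ)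
    (hw : 2 * algebraMap (𝓞 k) (𝓞 L) ζ + 1 ∈ w.asIdeal) : σ t = t := by
  have hw' : algebraMap (𝓞 k) (𝓞 K) (2 * ζ + 1) ∈ (w.under (𝓞 K)).asIdeal := by
    rw [algebraMap_mem_under_iff, map_add, map_mul, map_one, map_ofNat]
    exact hw
  obtain ⟨η, hη⟩ := h.admissible.cube_congr
  refine apply_eq_of_mem_inertia_of_congr_cube hσ h.zeta_top (smul_algebraMap_integer σ ζ)
    (a := algebraMap (𝓞 K) (𝓞 L) θ) (η := algebraMap (𝓞 K) (𝓞 L) η) h.cube_theta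
    (h.theta_notMem hw') (h.smul_algebraMap hσρ θ) (h.smul_algebraMap hσρ η) ?_
  rw [Ideal.mem_span_singleton, dvd_sub_comm] at hη
  rw [← algebraMap_threeSqrtNegThree, IsScalarTower.algebraMap_apply (𝓞 k) (𝓞 K) (𝓞 L), ← map_pow,
    ← map_sub]
  exact map_dvd _ hη

theorem exists_primeOrd_root_theta_eq (hσρ : σ (algebraMap K L ρ) = algebraMap K L ρ)
    (hσρ₂ : algebraMap (𝓞 k) (𝓞 L) π₂ ∈ w.asIdeal → σ ρ₂ = ρ₂) :
    ∃ c : L, c ≠ 0 ∧ σ c = c ∧ primeOrd w t = primeOrd w c := by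
  have hordt := h.three_mul_primeOrd_root_theta w
  by_cases hw : algebraMap (𝓞 k) (𝓞 L) π₂ ∈ w.asIdeal
  · refine ⟨ρ₂ ^ primeOrd (w.under (𝓞 K)) (algebraMap (𝓞 K) K θ),
      zpow_ne_zero _ h.root_two_ne_zero, by rw [map_zpow₀, hσρ₂ hw], ?_⟩
    have hord₂ : 3 * primeOrd w ρ₂ = w.asIdeal.ramificationIdx (𝓞 K) := by
      rw [← mul_one (w.asIdeal.ramificationIdx (𝓞 K) : ℤ),
        ← h.primeOrd_pi_two (algebraMap_mem_under_iff.2 hw), ← primeOrd_algebraMap (L := L),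
        IsScalarTower.algebraMap_apply (𝓞 k) k K, ← IsScalarTower.algebraMap_apply k K L,
        ← IsScalarTower.algebraMap_apply (𝓞 k) k L, ← h.cube₂, primeOrd_pow]
      rfl
    refine mul_left_cancel₀ (three_ne_zero (α := ℤ)) ?_
    rw [hordt, primeOrd_zpow, ← hord₂]
    ring
  · obtain ⟨m, hm⟩ := h.three_dvd_primeOrd_theta (w := w.under (𝓞 K))
      (mt algebraMap_mem_under_iff.1 hw)
    obtain ⟨c, hc0, hc⟩ := exists_primeOrd_eq (K := K) (w.under (𝓞 K)) m
    refine ⟨algebraMap K L c, by simpa using hc0, h.apply_algebraMap hσρ c, ?_⟩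
    refine mul_left_cancel₀ (three_ne_zero (α := ℤ)) ?_
    rw [hordt, hm, primeOrd_algebraMap (R := 𝓞 K), hc]
    ring

theorem eq_one_of_mem_inertia (hσ : σ ∈ w.asIdeal.inertia (L ≃ₐ[k] L))
    (hσρ : algebraMap (𝓞 k) (𝓞 L) π₁ ∈ w.asIdeal → σ (algebraMap K L ρ) = algebraMap K L ρ)
    (hσρ₂ : algebraMap (𝓞 k) (𝓞 L) π₂ ∈ w.asIdeal → σ ρ₂ = ρ₂) : σ = 1 := by
  replace hσρ : σ (algebraMap K L ρ) = algebraMap K L ρ := by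
    by_cases hw : algebraMap (𝓞 k) (𝓞 L) π₁ ∈ w.asIdeal
    · exact hσρ hw
    · exact apply_eq_of_mem_inertia_of_cube_eq hσ h.zeta h.primary h.cube_one hw
  replace hσρ₂ : σ ρ₂ = ρ₂ := by
    by_cases hw : algebraMap (𝓞 k) (𝓞 L) π₂ ∈ w.asIdeal
    · exact hσρ₂ hw
    · exact apply_eq_of_mem_inertia_of_cube_eq hσ h.zeta h.primary₂ h.cube₂ hw
  have hσt : σ t = t := by
    by_cases hw : 2 * algebraMap (𝓞 k) (𝓞 L) ζ + 1 ∈ w.asIdeal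
    · exact h.apply_root_theta_of_two_mul_zeta_add_one_mem hσ hσρ hw
    · obtain ⟨c, hc0, hσc, hc⟩ := h.exists_primeOrd_root_theta_eq (w := w) hσρ fun _ ↦ hσρ₂
      refine apply_eq_of_mem_inertia_of_valuation_eq hσ h.zeta_top hw h.root_theta_ne_zero ?_ hσc
        ((valuation_eq_iff_primeOrd_eq w h.root_theta_ne_zero hc0).2 hc)
      rw [← map_pow, h.cube_theta]
      exact h.apply_algebraMap hσρ _
  exact AlgEquiv.coe_toAlgHom_injective
    (algHom_ext_of_adjoin_eq_top h.adjoin_roots_eq_top (by simp [hσρ, hσρ₂, hσt]))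

theorem eq_one_of_mem_inertia_of_pi_one_mem (hw : algebraMap (𝓞 k) (𝓞 L) π₁ ∈ w.asIdeal) :
    ∀ σ ∈ w.asIdeal.inertia (L ≃ₐ[k] L), σ (algebraMap K L ρ) = algebraMap K L ρ → σ = 1 :=
  fun _ hσ hσρ ↦ h.eq_one_of_mem_inertia hσ (fun _ ↦ hσρ) fun hm ↦ absurd hw (h.pi_one_notMem hm)

theorem eq_one_of_mem_inertia_of_pi_two_mem (hw : algebraMap (𝓞 k) (𝓞 L) π₂ ∈ w.asIdeal) :
    ∀ σ ∈ w.asIdeal.inertia (L ≃ₐ[k] L), σ ρ₂ = ρ₂ → σ = 1 :=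
  fun _ hσ hσρ₂ ↦ h.eq_one_of_mem_inertia hσ (fun hm ↦ absurd hm (h.pi_one_notMem hw)) fun _ ↦ hσρ₂

variable [IsGalois k L]

theorem isUnramifiedAt (hw₁ : algebraMap (𝓞 k) (𝓞 L) π₁ ∉ w.asIdeal)
    (hw₂ : algebraMap (𝓞 k) (𝓞 L) π₂ ∉ w.asIdeal) : Algebra.IsUnramifiedAt (𝓞 k) w.asIdeal :=
  isUnramifiedAt_of_inertia_eq_bot (eq_bot_iff.2 fun _ hσ ↦
    h.eq_one_of_mem_inertia hσ (fun hm ↦ absurd hm hw₁) (fun hm ↦ absurd hm hw₂))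

theorem ramificationIdx_one (hw : algebraMap (𝓞 k) (𝓞 L) π₁ ∈ w.asIdeal) :
    w.asIdeal.ramificationIdx (𝓞 k) = 3 :=
  ramificationIdx_eq_of_prime_eq_pow three_pos h.prime h.cube_one hw
    (h.eq_one_of_mem_inertia_of_pi_one_mem hw)

theorem ramificationIdx_two (hw : algebraMap (𝓞 k) (𝓞 L) π₂ ∈ w.asIdeal) :
    w.asIdeal.ramificationIdx (𝓞 k) = 3 :=
  ramificationIdx_eq_of_prime_eq_pow three_pos h.prime₂ h.cube₂ hw
    (h.eq_one_of_mem_inertia_of_pi_two_mem hw)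

theorem exists_apply_root_one_ne :
    ∃ σ : L ≃ₐ[k] L, σ (algebraMap K L ρ) ≠ algebraMap K L ρ ∧ σ ρ₂ = ρ₂ := by
  obtain ⟨w, hw⟩ := exists_algebraMap_mem_of_prime (S := 𝓞 L) h.prime
  obtain ⟨σ, hσ, hσρ⟩ := exists_mem_inertia_apply_ne (w := w)
    (by rw [h.ramificationIdx_one hw]; decide) (h.eq_one_of_mem_inertia_of_pi_one_mem hw)
  exact ⟨σ, hσρ, apply_eq_of_mem_inertia_of_cube_eq hσ h.zeta h.primary₂ h.cube₂
    fun hm ↦ h.pi_one_notMem hm hw⟩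

theorem exists_apply_root_two_ne :
    ∃ σ : L ≃ₐ[k] L, σ (algebraMap K L ρ) = algebraMap K L ρ ∧ σ ρ₂ ≠ ρ₂ := by
  obtain ⟨w, hw⟩ := exists_algebraMap_mem_of_prime (S := 𝓞 L) h.prime₂
  obtain ⟨σ, hσ, hσρ₂⟩ := exists_mem_inertia_apply_ne (w := w)
    (by rw [h.ramificationIdx_two hw]; decide) (h.eq_one_of_mem_inertia_of_pi_two_mem hw)
  exact ⟨σ, apply_eq_of_mem_inertia_of_cube_eq hσ h.zeta h.primary h.cube_one (h.pi_one_notMem hw),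
    hσρ₂⟩

end IsRedeiExtension

section Unitriangular

variable {R : Type*} [CommRing R]

/-- The matrix of `N₃(R)` with entries `b`, `a` above the diagonal and `c` in the corner. -/
def unitriangular (a b c : R) : unitriangularGroup 3 R where
  val :=
    { val := !![1, b, c; 0, 1, a; 0, 0, 1]
      inv := !![1, -b, b * a - c; 0, 1, -a; 0, 0, 1]
      val_inv := by simp [Matrix.one_fin_three]
      inv_val := by
        simp [Matrix.one_fin_three]
        ring }
  property := by
    rw [unitriangularGroup, Submonoid.mem_units_iff]
    constructor <;> refine ⟨fun i ↦ ?_, fun i j hij ↦ ?_⟩ <;> fin_cases i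
    all_goals first | rfl | (fin_cases j <;> first | rfl | exact absurd hij (by decide))

theorem coe_unitriangular (a b c : R) :
    ((unitriangular a b c : GL (Fin 3) R) : Matrix (Fin 3) (Fin 3) R) =
      !![1, b, c; 0, 1, a; 0, 0, 1] := rfl

theorem unitriangular_mul (a b c a' b' c' : R) :
    unitriangular a b c * unitriangular a' b' c' =
      unitriangular (a + a') (b + b') (c + c' + b * a') := by
  refine Subtype.ext (Units.ext ?_)
  rw [Subgroup.coe_mul, Units.val_mul]
  simp only [coe_unitriangular]
  ext i j
  fin_cases i <;> fin_cases j <;> simp [Matrix.mul_apply, Fin.sum_univ_three] <;> ring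

theorem unitriangular_zero : unitriangular (0 : R) 0 0 = 1 :=
  Subtype.ext (Units.ext Matrix.one_fin_three.symm)

theorem unitriangular_inj {a b c a' b' c' : R} :
    unitriangular a b c = unitriangular a' b' c' ↔ a = a' ∧ b = b' ∧ c = c' := by
  refine ⟨fun h ↦ ?_, fun ⟨ha, hb, hc⟩ ↦ by rw [ha, hb, hc]⟩
  have hentry (i j : Fin 3) := congrArg
    (fun u : unitriangularGroup 3 R ↦ ((u : GL (Fin 3) R) : Matrix (Fin 3) (Fin 3) R) i j) h
  exact ⟨hentry 1 2, hentry 0 1, hentry 0 2⟩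

theorem exists_eq_unitriangular (u : unitriangularGroup 3 R) :
    ∃ a b c : R, u = unitriangular a b c := by
  let U : Matrix (Fin 3) (Fin 3) R := (u : GL (Fin 3) R)
  have hU : (∀ i, U i i = 1) ∧ ∀ i j, j < i → U i j = 0 :=
    ((Submonoid.mem_units_iff _ _).1 u.2).1
  refine ⟨U 1 2, U 0 1, U 0 2, Subtype.ext (Units.ext ?_)⟩
  rw [coe_unitriangular]
  change U = _
  ext i j
  fin_cases i <;> fin_cases j <;> simp [hU.1, hU.2]

theorem unitriangular_pow {a b : R} (hab : b * a = 0) (c : R) (m : ℕ) :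
    unitriangular a b c ^ m = unitriangular (m * a) (m * b) (m * c) := by
  induction m with
  | zero => simp [unitriangular_zero]
  | succ m ih =>
    rw [pow_succ, ih, unitriangular_mul, mul_assoc, hab]
    congr 1 <;> push_cast <;> ring

theorem eq_top_of_unitriangular_mem {p : ℕ} [Fact p.Prime]
    {H : Subgroup (unitriangularGroup 3 (ZMod p))} {a b c c' : ZMod p} (ha : a ≠ 0) (hb : b ≠ 0)
    (h₁ : unitriangular a 0 c ∈ H) (h₂ : unitriangular 0 b c' ∈ H) : H = ⊤ := by
  have hcomm : unitriangular 0 0 (b * a) * (unitriangular a 0 c * unitriangular 0 b c') =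
      unitriangular 0 b c' * unitriangular a 0 c := by
    simp only [unitriangular_mul, unitriangular_inj]
    refine ⟨by ring, by ring, by ring⟩
  have h₃ : unitriangular 0 0 (b * a) ∈ H := by
    rw [← H.mul_mem_cancel_right (H.mul_mem h₁ h₂), hcomm]
    exact H.mul_mem h₂ h₁
  refine eq_top_iff.2 fun u _ ↦ ?_
  obtain ⟨x, y, z, rfl⟩ := exists_eq_unitriangular u
  obtain ⟨i, hi⟩ := ZMod.natCast_zmod_surjective (x / a)
  obtain ⟨j, hj⟩ := ZMod.natCast_zmod_surjective (y / b)
  obtain ⟨l, hl⟩ :=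
    ZMod.natCast_zmod_surjective ((z - (i : ZMod p) * c - (j : ZMod p) * c') / (b * a))
  have hdecomp : unitriangular x y z =
      unitriangular a 0 c ^ i * unitriangular 0 b c' ^ j * unitriangular 0 0 (b * a) ^ l := by
    rw [unitriangular_pow (zero_mul a), unitriangular_pow (mul_zero b),
      unitriangular_pow (mul_zero 0), unitriangular_mul, unitriangular_mul, unitriangular_inj]
    rw [eq_div_iff ha] at hi
    rw [eq_div_iff hb] at hj
    rw [eq_div_iff (mul_ne_zero hb ha)] at hl
    refine ⟨?_, ?_, ?_⟩
    · linear_combination -hi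
    · linear_combination -hj
    · linear_combination -hl
  exact hdecomp ▸ H.mul_mem (H.mul_mem (H.pow_mem h₁ i) (H.pow_mem h₂ j)) (H.pow_mem h₃ l)

end Unitriangular

section Kummer

variable {k L : Type*} [Field k] [Field L] [Algebra k L] {p : ℕ} [NeZero p] {ζ : k}

theorem zmodChar_injective (hζ : IsPrimitiveRoot ζ p) :
    Function.Injective (AddChar.zmodChar p hζ.pow_eq_one) := fun i j hij ↦
  ZMod.val_injective p (hζ.pow_inj i.val_lt j.val_lt hij)

theorem zmodChar_smul_eq_iff (hζ : IsPrimitiveRoot ζ p) {u : L} (hu : u ≠ 0) {i : ZMod p} :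
    AddChar.zmodChar p hζ.pow_eq_one i • u = u ↔ i = 0 := by
  rw [← (zmodChar_injective hζ).eq_iff, AddChar.map_zero_eq_one, Algebra.smul_def,
    mul_eq_right₀ hu, ← map_one (algebraMap k L), (algebraMap k L).injective.eq_iff]

theorem exists_eq_zmodChar_smul (hζ : IsPrimitiveRoot ζ p) {u v : L} (h : u ^ p = v ^ p) :
    ∃ i, u = AddChar.zmodChar p hζ.pow_eq_one i • v := by
  obtain ⟨ω, hω, rfl⟩ := exists_eq_mul_of_pow_eq_pow (NeZero.ne p) h
  obtain ⟨i, hi, rfl⟩ :=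
    (hζ.map_of_injective (algebraMap k L).injective).eq_pow_of_pow_eq_one hω
  refine ⟨i, ?_⟩
  rw [AddChar.zmodChar_apply, ZMod.val_natCast_of_lt hi, Algebra.smul_def, map_pow]

end Kummer

/-- `K = k(ρ)` is a Kummer extension of `k` with automorphism `τ`, and `r`, `t` are `p`-th roots in
an extension `L` of `β ∈ k` and of `θ ∈ K`, where `τ θ` differs from `θ` by the factor
`β ^ n * x ^ p`, and `β ^ n` times the norm of `x` is `1`. -/
structure IsTwistedKummerDatum {k K L : Type*} [Field k] [Field K] [Field L] [Algebra k K]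
    [Algebra k L] [Algebra K L] (p n : ℕ) (ζ α β : k) (ρ : K) (τ : K ≃ₐ[k] K) (θ x : K)
    (r t : L) : Prop extends IsKummerExtension p ζ α ρ τ where
  beta_root_ne_zero : r ≠ 0
  theta_root_ne_zero : t ≠ 0
  beta_root_pow : r ^ p = algebraMap k L β
  theta_root_pow : t ^ p = algebraMap K L θ
  apply_theta : τ θ = θ * algebraMap k K β ^ n * x ^ p
  mul_prod_eq_one : algebraMap k K β ^ n * ∏ i ∈ Finset.range p, (τ ^ i) x = 1

section Conjugate

variable {k K L : Type*} [Field k] [Field K] [Field L] [Algebra k K] [Algebra K L]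

/-- The `p`-th root of `τ ^ j θ` obtained from the `p`-th root `t` of `θ` by iterating the relation
`τ θ = θ * (r ^ p) ^ n * x ^ p`. -/
def conjugateRoot (τ : K ≃ₐ[k] K) (n : ℕ) (x : K) (r t : L) (j : ℕ) : L :=
  t * ∏ i ∈ Finset.range j, r ^ n * algebraMap K L ((τ ^ i) x)

theorem conjugateRoot_zero (τ : K ≃ₐ[k] K) (n : ℕ) (x : K) (r t : L) :
    conjugateRoot τ n x r t 0 = t := by
  rw [conjugateRoot, Finset.prod_range_zero, mul_one]

theorem conjugateRoot_succ (τ : K ≃ₐ[k] K) (n : ℕ) (x : K) (r t : L) (j : ℕ) :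
    conjugateRoot τ n x r t (j + 1) =
      conjugateRoot τ n x r t j * (r ^ n * algebraMap K L ((τ ^ j) x)) := by
  rw [conjugateRoot, Finset.prod_range_succ, ← mul_assoc, conjugateRoot]

end Conjugate

namespace IsTwistedKummerDatum

variable {k K L : Type*} [Field k] [Field K] [Field L] [Algebra k K] [Algebra k L] [Algebra K L]
  {p n : ℕ} {ζ α β : k} {ρ : K} {τ : K ≃ₐ[k] K} {θ x : K} {r t : L}
  {h : IsTwistedKummerDatum p n ζ α β ρ τ θ x r t}

section

variable (h) [NeZero p]
include h

theorem factor_ne_zero : x ≠ 0 := by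
  have hx := right_ne_zero_of_mul_eq_one h.mul_prod_eq_one
  simpa using Finset.prod_ne_zero_iff.1 hx 0 (Finset.mem_range.2 (NeZero.pos p))

/-- The additive character `i ↦ ζ ^ i` of `ℤ/p`. -/
def character : AddChar (ZMod p) k := AddChar.zmodChar p h.zeta.pow_eq_one

/-- The automorphism `g` multiplies `ρ` by `ζ ^ a` and `r` by `ζ ^ b`, and takes `t` to `ζ ^ c`
times the chosen root of `τ ^ a θ`. -/
structure HasCoordinates (g : L ≃ₐ[k] L) (a b c : ZMod p) : Prop where
  apply_root : g (algebraMap K L ρ) = h.character a • algebraMap K L ρ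
  apply_beta_root : g r = h.character b • r
  apply_theta_root : g t = h.character c • conjugateRoot τ n x r t a.val

end

namespace HasCoordinates

variable [NeZero p] {g g' : L ≃ₐ[k] L} {a b c : ZMod p}

theorem eq (hgen : IntermediateField.adjoin k {algebraMap K L ρ, r, t} = ⊤)
    (hg : h.HasCoordinates g a b c) (hg' : h.HasCoordinates g' a b c) : g = g' := by
  refine AlgEquiv.coe_toAlgHom_injective (algHom_ext_of_adjoin_eq_top hgen ?_)
  rintro _ (rfl | rfl | rfl)
  · exact hg.apply_root.trans hg'.apply_root.symm
  · exact hg.apply_beta_root.trans hg'.apply_beta_root.symm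
  · exact hg.apply_theta_root.trans hg'.apply_theta_root.symm

theorem apply_root_eq_iff (hg : h.HasCoordinates g a b c) :
    g (algebraMap K L ρ) = algebraMap K L ρ ↔ a = 0 := by
  rw [hg.apply_root]
  exact zmodChar_smul_eq_iff h.zeta ((map_ne_zero (algebraMap K L)).2 h.root_ne_zero)

theorem apply_beta_root_eq_iff (hg : h.HasCoordinates g a b c) : g r = r ↔ b = 0 := by
  rw [hg.apply_beta_root]
  exact zmodChar_smul_eq_iff h.zeta h.beta_root_ne_zero

end HasCoordinates

variable [IsScalarTower k K L]

section

variable (h)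
include h

theorem conjugateRoot_pow (j : ℕ) :
    conjugateRoot τ n x r t j ^ p = algebraMap K L ((τ ^ j) θ) := by
  induction j with
  | zero => rw [conjugateRoot_zero, h.theta_root_pow, pow_zero, AlgEquiv.one_apply]
  | succ j ih =>
    rw [conjugateRoot_succ, mul_pow, ih, mul_pow, ← pow_mul, mul_comm n, pow_mul, h.beta_root_pow,
      pow_succ, AlgEquiv.mul_apply, h.apply_theta, IsScalarTower.algebraMap_apply k K L]
    simp only [map_mul, map_pow, AlgEquiv.commutes]
    ring

theorem conjugateRoot_periodic : Function.Periodic (conjugateRoot τ n x r t) p := by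
  intro j
  have hprod : ∏ i ∈ Finset.range p, r ^ n * algebraMap K L ((τ ^ (j + i)) x) =
      algebraMap K L
        ((τ ^ j) (algebraMap k K β ^ n * ∏ i ∈ Finset.range p, (τ ^ i) x)) := by
    rw [Finset.prod_mul_distrib, Finset.prod_const, Finset.card_range, ← pow_mul, mul_comm n,
      pow_mul, h.beta_root_pow, IsScalarTower.algebraMap_apply k K L]
    simp only [pow_add, AlgEquiv.mul_apply, map_mul, map_pow, map_prod, AlgEquiv.commutes]
  rw [conjugateRoot, Finset.prod_range_add, hprod, h.mul_prod_eq_one, map_one, map_one, mul_one,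
    conjugateRoot]

variable [NeZero p]

theorem conjugateRoot_ne_zero (j : ℕ) : conjugateRoot τ n x r t j ≠ 0 := by
  rw [← pow_ne_zero_iff (NeZero.ne p), h.conjugateRoot_pow]
  have hθ : algebraMap K L θ ≠ 0 := h.theta_root_pow ▸ pow_ne_zero p h.theta_root_ne_zero
  rwa [map_ne_zero, map_ne_zero, ← map_ne_zero (algebraMap K L)]

theorem character_smul_root (a : ZMod p) :
    h.character a • algebraMap K L ρ = algebraMap K L ((τ ^ a.val) ρ) := by
  rw [h.pow_apply_root, map_mul, ← IsScalarTower.algebraMap_apply, ← Algebra.smul_def]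
  rfl

theorem exists_hasCoordinates (g : L ≃ₐ[k] L) : ∃ a b c, h.HasCoordinates g a b c := by
  obtain ⟨a, ha⟩ := exists_eq_zmodChar_smul h.zeta
    (show g (algebraMap K L ρ) ^ p = algebraMap K L ρ ^ p by
      rw [← map_pow, ← map_pow, h.root_pow, ← IsScalarTower.algebraMap_apply, AlgEquiv.commutes])
  obtain ⟨b, hb⟩ := exists_eq_zmodChar_smul h.zeta
    (show g r ^ p = r ^ p by rw [← map_pow, h.beta_root_pow, AlgEquiv.commutes])
  have hρ : (g : L →ₐ[k] L) (algebraMap K L ρ) = algebraMap K L ((τ ^ a.val) ρ) :=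
    ha.trans (h.character_smul_root a)
  obtain ⟨c, hc⟩ := exists_eq_zmodChar_smul h.zeta
    (show g t ^ p = conjugateRoot τ n x r t a.val ^ p by
      rw [← map_pow, h.theta_root_pow, h.conjugateRoot_pow]
      exact h.apply_algebraMap_eq hρ θ)
  exact ⟨a, b, c, ha, hb, hc⟩

end

namespace HasCoordinates

variable [NeZero p] {g g' : L ≃ₐ[k] L} {a a' b b' c c' : ZMod p}

theorem apply_conjugateRoot (hg : h.HasCoordinates g a b c) (j : ℕ) :
    g (conjugateRoot τ n x r t j) =
      h.character (c + n * b * j) • conjugateRoot τ n x r t (j + a.val) := by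
  have hρ : (g : L →ₐ[k] L) (algebraMap K L ρ) = algebraMap K L ((τ ^ a.val) ρ) :=
    hg.apply_root.trans (h.character_smul_root a)
  induction j with
  | zero => simpa [conjugateRoot_zero] using hg.apply_theta_root
  | succ j ih =>
    have hx : g (algebraMap K L ((τ ^ j) x)) = algebraMap K L ((τ ^ (j + a.val)) x) := by
      rw [add_comm j, pow_add, AlgEquiv.mul_apply]
      exact h.apply_algebraMap_eq hρ _
    have hχ : h.character (c + n * b * (j + 1 : ℕ)) =
        h.character (c + n * b * j) * h.character b ^ n := by
      rw [← AddChar.map_nsmul_eq_pow, ← AddChar.map_add_eq_mul, nsmul_eq_mul]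
      push_cast
      ring_nf
    rw [conjugateRoot_succ, map_mul, map_mul, map_pow, ih, hx, hg.apply_beta_root, smul_pow,
      add_right_comm, conjugateRoot_succ, hχ, smul_mul_assoc, smul_mul_assoc, mul_smul_comm,
      smul_smul]

theorem mul (hg : h.HasCoordinates g a b c) (hg' : h.HasCoordinates g' a' b' c') :
    h.HasCoordinates (g * g') (a + a') (b + b') (c + c' + n * b * a') where
  apply_root := by
    rw [AlgEquiv.mul_apply, hg'.apply_root, map_smul, hg.apply_root, smul_smul,
      ← AddChar.map_add_eq_mul, add_comm a']
  apply_beta_root := by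
    rw [AlgEquiv.mul_apply, hg'.apply_beta_root, map_smul, hg.apply_beta_root, smul_smul,
      ← AddChar.map_add_eq_mul, add_comm b']
  apply_theta_root := by
    rw [AlgEquiv.mul_apply, hg'.apply_theta_root, map_smul, hg.apply_conjugateRoot,
      ZMod.natCast_zmod_val, smul_smul, ← AddChar.map_add_eq_mul, add_comm a a', ZMod.val_add,
      h.conjugateRoot_periodic.map_mod_nat]
    ring_nf

theorem unique (hg : h.HasCoordinates g a b c) (hg' : h.HasCoordinates g a' b' c') :
    a = a' ∧ b = b' ∧ c = c' := by
  have hinj := zmodChar_injective h.zeta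
  have ha : a = a' := hinj <| smul_left_injective k
    ((map_ne_zero (algebraMap K L)).2 h.root_ne_zero) (hg.apply_root.symm.trans hg'.apply_root)
  subst ha
  exact ⟨rfl,
    hinj <| smul_left_injective k h.beta_root_ne_zero
      (hg.apply_beta_root.symm.trans hg'.apply_beta_root),
    hinj <| smul_left_injective k (h.conjugateRoot_ne_zero a.val)
      (hg.apply_theta_root.symm.trans hg'.apply_theta_root)⟩

end HasCoordinates

section Subfield

variable {F : IntermediateField k L} (h)
include h

theorem conjugateRoot_mem (hρ : algebraMap K L ρ ∈ F) (hr : r ∈ F) (ht : t ∈ F) (j : ℕ) :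
    conjugateRoot τ n x r t j ∈ F :=
  F.mul_mem ht (prod_mem fun _ _ ↦ F.mul_mem (pow_mem hr n) (h.algebraMap_mem_of_root_mem hρ _))

variable [NeZero p]

theorem normal_adjoin_roots [Normal k L] :
    Normal k (IntermediateField.adjoin k {algebraMap K L ρ, r, t}) := by
  let F := IntermediateField.adjoin k {algebraMap K L ρ, r, t}
  have hρF : algebraMap K L ρ ∈ F := IntermediateField.subset_adjoin _ _ (by simp)
  have hrF : r ∈ F := IntermediateField.subset_adjoin _ _ (by simp)
  have htF : t ∈ F := IntermediateField.subset_adjoin _ _ (by simp)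
  have := h.isGalois
  refine IntermediateField.normal_iff_forall_map_le.2 fun σ ↦ ?_
  have hσ (y : K) : σ (algebraMap K L y) = algebraMap K L (σ.restrictNormal' K y) :=
    (σ.restrictNormal_commutes K y).symm
  rw [IntermediateField.adjoin_map, IntermediateField.adjoin_le_iff]
  rintro _ ⟨_, rfl | rfl | rfl, rfl⟩
  · exact (hσ ρ).symm ▸ h.algebraMap_mem_of_root_mem hρF _
  · refine mem_of_pow_eq_pow h.zeta hrF ?_
    rw [← map_pow, h.beta_root_pow, AlgHom.commutes]
  · obtain ⟨j, hj⟩ := h.exists_eq_pow (σ.restrictNormal' K)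
    refine mem_of_pow_eq_pow h.zeta (h.conjugateRoot_mem hρF hrF htF j) ?_
    rw [h.conjugateRoot_pow, ← hj, ← hσ, ← h.theta_root_pow, map_pow]

theorem adjoin_roots_eq [FiniteDimensional k K] [Fact p.Prime] (hn : ¬ p ∣ n) (hθ : τ θ ≠ θ)
    {s : Fin p → L} (hs : ∀ j : Fin p, s j ^ p = algebraMap K L ((τ ^ (j : ℕ)) θ)) :
    IntermediateField.adjoin k {algebraMap K L ρ, r, t} =
      IntermediateField.adjoin k (Set.range s) := by
  apply le_antisymm
  · let F := IntermediateField.adjoin k (Set.range s)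
    have hF (j : Fin p) : conjugateRoot τ n x r t j ∈ F :=
      mem_of_pow_eq_pow h.zeta (IntermediateField.subset_adjoin k _ (Set.mem_range_self j))
        (by rw [h.conjugateRoot_pow, hs])
    have htF : t ∈ F := by
      simpa only [conjugateRoot_zero] using hF ⟨0, Nat.Prime.pos Fact.out⟩
    have hKF := h.algebraMap_mem_of_apply_ne hθ (F := F) (h.theta_root_pow ▸ pow_mem htF p)
    have hrF : r ∈ F := by
      refine mem_of_coprime_of_pow_mem ((Nat.Prime.coprime_iff_not_dvd Fact.out).2 hn)
        (h.beta_root_pow ▸ F.algebraMap_mem β) ?_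
      have hF1 : t * (r ^ n * algebraMap K L x) ∈ F := by
        simpa only [conjugateRoot_succ, conjugateRoot_zero, pow_zero, AlgEquiv.one_apply]
          using hF ⟨1, Nat.Prime.one_lt Fact.out⟩
      have hx : algebraMap K L x ≠ 0 := (map_ne_zero _).2 h.factor_ne_zero
      convert F.div_mem hF1 (F.mul_mem htF (hKF x)) using 1
      field_simp [h.theta_root_ne_zero]
    rw [IntermediateField.adjoin_le_iff]
    rintro _ (rfl | rfl | rfl)
    exacts [hKF ρ, hrF, htF]
  · let F := IntermediateField.adjoin k {algebraMap K L ρ, r, t}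
    rw [IntermediateField.adjoin_le_iff]
    rintro _ ⟨j, rfl⟩
    refine mem_of_pow_eq_pow h.zeta (h.conjugateRoot_mem (F := F) ?_ ?_ ?_ j)
      (by rw [h.conjugateRoot_pow, hs])
    all_goals exact IntermediateField.subset_adjoin _ _ (by simp)

end Subfield

section Prime

variable [Fact p.Prime] (h) (hn : ¬ p ∣ n)
  (hgen : IntermediateField.adjoin k {algebraMap K L ρ, r, t} = ⊤)
include h hn hgen

theorem exists_monoidHom : ∃ F : (L ≃ₐ[k] L) →* unitriangularGroup 3 (ZMod p),
    Function.Injective F ∧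
      ∀ g a b c, h.HasCoordinates g a b c → F g = unitriangular a (n * b) c := by
  have hn0 : (n : ZMod p) ≠ 0 := by rwa [Ne, ZMod.natCast_eq_zero_iff]
  choose a b c hcoord using h.exists_hasCoordinates
  let F : (L ≃ₐ[k] L) →* unitriangularGroup 3 (ZMod p) := MonoidHom.mk'
    (fun g ↦ unitriangular (a g) (n * b g) (c g)) fun g g' ↦ by
      obtain ⟨ha, hb, hc⟩ := (hcoord (g * g')).unique ((hcoord g).mul (hcoord g'))
      rw [unitriangular_mul, unitriangular_inj, ha, hb, hc]
      exact ⟨rfl, mul_add _ _ _, rfl⟩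
  refine ⟨F, fun g g' hF ↦ ?_, fun g a' b' c' hg ↦ ?_⟩
  · obtain ⟨ha, hb, hc⟩ := unitriangular_inj.1 hF
    have hg' := hcoord g'
    rw [← ha, ← mul_left_cancel₀ hn0 hb, ← hc] at hg'
    exact (hcoord g).eq hgen hg'
  · obtain ⟨rfl, rfl, rfl⟩ := hg.unique (hcoord g)
    rfl

theorem nonempty_mulEquiv
    (h₁ : ∃ g : L ≃ₐ[k] L, g (algebraMap K L ρ) ≠ algebraMap K L ρ ∧ g r = r)
    (h₂ : ∃ g : L ≃ₐ[k] L, g (algebraMap K L ρ) = algebraMap K L ρ ∧ g r ≠ r) :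
    Nonempty ((L ≃ₐ[k] L) ≃* unitriangularGroup 3 (ZMod p)) := by
  have hn0 : (n : ZMod p) ≠ 0 := by rwa [Ne, ZMod.natCast_eq_zero_iff]
  obtain ⟨F, hinj, hF⟩ := h.exists_monoidHom hn hgen
  obtain ⟨g₁, hg₁, hg₁'⟩ := h₁
  obtain ⟨g₂, hg₂, hg₂'⟩ := h₂
  obtain ⟨a₁, b₁, c₁, hcoord₁⟩ := h.exists_hasCoordinates g₁
  obtain ⟨a₂, b₂, c₂, hcoord₂⟩ := h.exists_hasCoordinates g₂
  rw [Ne, hcoord₁.apply_root_eq_iff] at hg₁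
  rw [Ne, hcoord₂.apply_beta_root_eq_iff] at hg₂'
  obtain rfl := hcoord₁.apply_beta_root_eq_iff.1 hg₁'
  obtain rfl := hcoord₂.apply_root_eq_iff.1 hg₂
  have htop : F.range = ⊤ := eq_top_of_unitriangular_mem hg₁ (mul_ne_zero hn0 hg₂')
    ⟨g₁, by rw [hF _ _ _ _ hcoord₁, mul_zero]⟩ ⟨g₂, hF _ _ _ _ hcoord₂⟩
  exact ⟨MulEquiv.ofBijective F ⟨hinj, MonoidHom.range_eq_top.1 htop⟩⟩

end Prime

end IsTwistedKummerDatum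

theorem IsKummerExtension.mul_prod_eq_one {k K : Type*} [Field k] [Field K] [Algebra k K]
    [FiniteDimensional k K] {ζ α b c : k} {ρ x y : K} {τ : K ≃ₐ[k] K}
    (h : IsKummerExtension 3 ζ α ρ τ) (hy : y ≠ 0) (hc : Algebra.norm k y = c ^ 3)
    (hτy : τ y = y * algebraMap k K b * x ^ 3) :
    algebraMap k K b * ∏ i ∈ Finset.range 3, (τ ^ i) x = 1 := by
  have hb : τ (algebraMap k K b) = algebraMap k K b := τ.commutes b
  have hcube : algebraMap k K c ^ 3 = (y * algebraMap k K b * x ^ 2 * τ x) ^ 3 := by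
    rw [← map_pow, ← hc, h.norm_eq_prod]
    simp only [Finset.prod_range_succ, Finset.prod_range_zero, pow_zero, pow_one, pow_two τ,
      AlgEquiv.one_apply, AlgEquiv.mul_apply, hτy, map_mul, map_pow, hb]
    ring
  obtain ⟨ω, hω, hcω⟩ := exists_eq_mul_of_pow_eq_pow three_ne_zero hcube
  obtain ⟨i, -, rfl⟩ :=
    (h.zeta.map_of_injective (algebraMap k K).injective).eq_pow_of_pow_eq_one hω
  have hc0 : algebraMap k K c ≠ 0 := by
    rw [map_ne_zero, ← pow_ne_zero_iff three_ne_zero, ← hc]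
    exact Algebra.norm_ne_zero_iff.2 hy
  -- `c` is fixed by `τ`, while `τ` multiplies its expression through `y` and `x` by `b * N(x)`
  have hfix := τ.commutes c
  refine mul_left_cancel₀ hc0 ?_
  nth_rw 2 [← hfix]
  rw [hcω]
  simp only [Finset.prod_range_succ, Finset.prod_range_zero, pow_zero, pow_one, pow_two τ,
    AlgEquiv.one_apply, AlgEquiv.mul_apply, map_mul, map_pow, AlgEquiv.commutes, hτy]
  ring

namespace IsAdmissibleDatum

variable {k K : Type*} [Field k] [NumberField k] [IsCyclotomicExtension {3} ℚ k] [Field K]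
  [NumberField K] [Algebra k K] {ζ π₁ π₂ : 𝓞 k} {ρ : K} {τ : K ≃ₐ[k] K}
  {P : HeightOneSpectrum (𝓞 K)} {θ : 𝓞 K} (h : IsAdmissibleDatum ζ π₁ π₂ ρ τ P θ)
include h

theorem exists_isTwistedKummerDatum {L : Type*} [Field L] [Algebra k L] [Algebra K L]
    {ρ₂ t : L} (hρ₂ : ρ₂ ^ 3 = algebraMap k L π₂) (ht : t ^ 3 = algebraMap K L θ) :
    ∃ n x, ¬ 3 ∣ n ∧
      IsTwistedKummerDatum 3 n (ζ : k) (π₁ : k) (π₂ : k) ρ τ (θ : K) x ρ₂ t := by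
  obtain ⟨n, x, hn, hx⟩ := h.exists_apply_theta_eq
  have hx' : τ (θ : K) = θ * algebraMap k K ((π₂ : k) ^ n) * x ^ 3 := by
    rw [hx, map_pow]
    rfl
  obtain ⟨u, hu⟩ := h.admissible.norm_eq
  have hprod := h.isKummerExtension.mul_prod_eq_one h.theta_ne_zero
    (hu.trans (mul_pow _ _ _).symm) hx'
  refine ⟨n, x, hn, { h.isKummerExtension with
    beta_root_ne_zero := ?_
    theta_root_ne_zero := ?_
    beta_root_pow := hρ₂
    theta_root_pow := ht
    apply_theta := hx
    mul_prod_eq_one := map_pow (algebraMap k K) _ _ ▸ hprod }⟩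
  · rintro rfl
    exact h.prime₂.ne_zero (by simpa using hρ₂.symm)
  · rintro rfl
    exact h.theta_ne_zero (by simpa using ht.symm)

end IsAdmissibleDatum

theorem IsRedeiExtension.nonempty_mulEquiv {k K L : Type*} [Field k] [NumberField k]
    [IsCyclotomicExtension {3} ℚ k] [Field K] [NumberField K] [Field L] [NumberField L]
    [Algebra k K] [Algebra k L] [Algebra K L] [IsScalarTower k K L] [IsGalois k L]
    {ζ π₁ π₂ : 𝓞 k} {ρ : K} {τ : K ≃ₐ[k] K} {P : HeightOneSpectrum (𝓞 K)} {θ : 𝓞 K} {ρ₂ t : L}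
    (h : IsRedeiExtension ζ π₁ π₂ ρ τ P θ ρ₂ t) :
    Nonempty ((L ≃ₐ[k] L) ≃* unitriangularGroup 3 (ZMod 3)) := by
  obtain ⟨n, x, hn, hdatum⟩ := h.exists_isTwistedKummerDatum h.cube₂ h.cube_theta
  exact hdatum.nonempty_mulEquiv hn h.adjoin_roots_eq_top h.exists_apply_root_one_ne
    h.exists_apply_root_two_ne

namespace IsPrimaryGenerator

variable {k : Type*} [Field k] [NumberField k] {ζ π : 𝓞 k} {𝔭 : Ideal (𝓞 k)}
  (h : IsPrimaryGenerator ζ 𝔭 π)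
include h

theorem prime : Prime π := by
  refine (Ideal.span_singleton_prime ?_).1 (h.eq_span ▸ h.isPrime)
  rintro rfl
  have hN := h.absNorm_modEq
  rw [h.eq_span, Ideal.span_singleton_zero, Ideal.absNorm_bot] at hN
  exact absurd hN (by decide)

theorem isMaximal : 𝔭.IsMaximal :=
  h.isPrime.isMaximal (by simpa [h.eq_span] using h.prime.ne_zero)

theorem mem_iff {a : 𝓞 k} : a ∈ 𝔭 ↔ π ∣ a := by
  rw [h.eq_span, Ideal.mem_span_singleton]

theorem liesOver_iff {L : Type*} [Field L] [Algebra k L] {Q : Ideal (𝓞 L)} [hQ : Q.IsPrime] :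
    Q.LiesOver 𝔭 ↔ algebraMap (𝓞 k) (𝓞 L) π ∈ Q := by
  refine ⟨fun _ ↦ (Ideal.mem_of_liesOver Q 𝔭 π).1 (h.mem_iff.2 dvd_rfl), fun hm ↦ ⟨?_⟩⟩
  refine h.isMaximal.eq_of_le (hQ.comap _).ne_top fun x hx ↦ ?_
  exact Ideal.mem_of_dvd (Q.comap (algebraMap (𝓞 k) (𝓞 L))) (h.mem_iff.1 hx) hm

theorem ne_bot_of_liesOver {L : Type*} [Field L] [Algebra k L] {Q : Ideal (𝓞 L)} [Q.IsPrime]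
    (hQ : Q.LiesOver 𝔭) : Q ≠ ⊥ := by
  rintro rfl
  exact h.prime.ne_zero (by simpa using h.liesOver_iff.1 hQ)

theorem not_dvd {𝔮 : Ideal (𝓞 k)} {ϖ : 𝓞 k} (h' : IsPrimaryGenerator ζ 𝔮 ϖ) (hne : 𝔭 ≠ 𝔮) :
    ¬ ϖ ∣ π := fun hd ↦ hne <| h.isMaximal.eq_of_le h'.isMaximal.ne_top fun _ hx ↦
  h'.mem_iff.2 (hd.trans (h.mem_iff.1 hx))

end IsPrimaryGenerator

theorem isUnramifiedAtInfinitePlaces_of_isTotallyComplex (k L : Type*) [Field k]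
    [IsTotallyComplex k] [Field L] [Algebra k L] : IsUnramifiedAtInfinitePlaces k L where
  isUnramified _ := InfinitePlace.isUnramified_iff.2 (.inr (IsTotallyComplex.isComplex _))

theorem adjoin_eq_top_of_adjoin_coe_eq {k Ω : Type*} [Field k] [Field Ω] [Algebra k Ω]
    {F : IntermediateField k Ω} {S : Set F}
    (h : IntermediateField.adjoin k (Subtype.val '' S) = F) : IntermediateField.adjoin k S = ⊤ := by
  apply IntermediateField.lift_injective F
  rw [IntermediateField.lift_adjoin, h, IntermediateField.lift_top]

theorem IsAdmissibleDatum.isRedeiExtension {k K Ω : Type*} [Field k] [NumberField k] [Field K]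
    [NumberField K] [Field Ω] [Algebra k K] [Algebra k Ω] [Algebra K Ω] {ζ π₁ π₂ : 𝓞 k} {ρ : K}
    {τ : K ≃ₐ[k] K} {P : HeightOneSpectrum (𝓞 K)} {θ : 𝓞 K}
    (h : IsAdmissibleDatum ζ π₁ π₂ ρ τ P θ) {F : IntermediateField k Ω} [NumberField F]
    [Algebra K F] [IsScalarTower K F Ω] {ρ₂ t : F} (hρ₂ : (ρ₂ : Ω) ^ 3 = algebraMap k Ω π₂)
    (ht : (t : Ω) ^ 3 = algebraMap K Ω θ)
    (hF : F = IntermediateField.adjoin k {algebraMap K Ω ρ, (ρ₂ : Ω), (t : Ω)}) :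
    IsRedeiExtension ζ π₁ π₂ ρ τ P θ ρ₂ t :=
  { h with
    cube₂ := Subtype.ext hρ₂
    cube_theta := Subtype.ext (ht.trans (IsScalarTower.algebraMap_apply K F Ω _))
    adjoin_roots_eq_top := adjoin_eq_top_of_adjoin_coe_eq <| by
      rw [Set.image_insert_eq, Set.image_pair]
      exact (IsScalarTower.algebraMap_apply K F Ω ρ ▸ hF).symm }

theorem IsPrimaryGenerator.isAdmissibleDatum {k Ω : Type*} [Field k] [NumberField k] [Field Ω]
    [Algebra k Ω] [Algebra.IsAlgebraic k Ω] {ζ π₁ π₂ : 𝓞 k} {𝔭₁ 𝔭₂ : Ideal (𝓞 k)}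
    (h₁ : IsPrimaryGenerator ζ 𝔭₁ π₁) (h₂ : IsPrimaryGenerator ζ 𝔭₂ π₂)
    (hζ : IsPrimitiveRoot ζ 3) (hne : 𝔭₁ ≠ 𝔭₂) (h₁₂ : IsCubicResidueSymbol π₁ 𝔭₂ 1) {ρ₁ : Ω}
    (hρ₁ : ρ₁ ^ 3 = algebraMap k Ω π₁) {τ : k⟮ρ₁⟯ ≃ₐ[k] k⟮ρ₁⟯}
    (hτ : (τ (IntermediateField.AdjoinSimple.gen k ρ₁) : Ω) = algebraMap k Ω ζ * ρ₁)
    {P : HeightOneSpectrum (𝓞 k⟮ρ₁⟯)} (hP : P.asIdeal.LiesOver 𝔭₂) {θ : 𝓞 k⟮ρ₁⟯}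
    (hθ : IsAdmissible ζ π₂ τ P.asIdeal θ) :
    IsAdmissibleDatum ζ π₁ π₂ (IntermediateField.AdjoinSimple.gen k ρ₁) τ P θ := by
  have := h₂.isMaximal
  have hnd : ¬ π₂ ∣ π₁ := h₁.not_dvd h₂ hne
  obtain ⟨b, hb⟩ :=
    h₁₂.exists_sub_cube_mem (h₂.absNorm_modEq.of_mul_right 3) (mt h₂.mem_iff.1 hnd)
  exact
    { zeta := hζ
      prime := h₁.prime
      primary := Ideal.mem_span_singleton.1 h₁.congr_one
      cube := Subtype.ext hρ₁
      adjoin_eq_top := adjoin_eq_top_of_adjoin_coe_eq (by rw [Set.image_singleton]; rfl)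
      apply_root := Subtype.ext hτ
      prime₂ := h₂.prime
      primary₂ := Ideal.mem_span_singleton.1 h₂.congr_one
      not_dvd := hnd
      cube_residue := ⟨b, h₂.mem_iff.1 hb⟩
      mem := h₂.liesOver_iff.1 hP
      admissible := hθ }

namespace IsRedeiExtension

variable {k K L : Type*} [Field k] [NumberField k] [IsCyclotomicExtension {3} ℚ k] [Field K]
  [NumberField K] [Field L] [NumberField L] [Algebra k K] [Algebra k L] [Algebra K L]
  [IsScalarTower k K L] [IsGalois k L] {ζ π₁ π₂ : 𝓞 k} {𝔭₁ 𝔭₂ : Ideal (𝓞 k)} {ρ : K}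
  {τ : K ≃ₐ[k] K} {P : HeightOneSpectrum (𝓞 K)} {θ : 𝓞 K} {ρ₂ t : L}
  (h : IsRedeiExtension ζ π₁ π₂ ρ τ P θ ρ₂ t) (h₁ : IsPrimaryGenerator ζ 𝔭₁ π₁)
  (h₂ : IsPrimaryGenerator ζ 𝔭₂ π₂) {Q : Ideal (𝓞 L)} [hQ : Q.IsPrime]
include h h₁ h₂

theorem isUnramifiedAt_of_not_liesOver (hQ₁ : ¬ Q.LiesOver 𝔭₁) (hQ₂ : ¬ Q.LiesOver 𝔭₂) :
    Algebra.IsUnramifiedAt (𝓞 k) Q := by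
  rcases eq_or_ne Q ⊥ with rfl | hQ0
  · exact Algebra.isUnramifiedAt_bot
  · exact h.isUnramifiedAt (w := ⟨Q, hQ, hQ0⟩) (mt h₁.liesOver_iff.2 hQ₁)
      (mt h₂.liesOver_iff.2 hQ₂)

theorem ramificationIdx_of_liesOver (hQ' : Q.LiesOver 𝔭₁ ∨ Q.LiesOver 𝔭₂) :
    Q.ramificationIdx (𝓞 k) = 3 := by
  rcases hQ' with hQ' | hQ'
  · exact h.ramificationIdx_one (w := ⟨Q, hQ, h₁.ne_bot_of_liesOver hQ'⟩) (h₁.liesOver_iff.1 hQ')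
  · exact h.ramificationIdx_two (w := ⟨Q, hQ, h₂.ne_bot_of_liesOver hQ'⟩) (h₂.liesOver_iff.1 hQ')

end IsRedeiExtension

theorem theorem4p10
    {k : Type*} [Field k] [NumberField k] [IsCyclotomicExtension {3} ℚ k]
    {Ω : Type*} [Field Ω] [Algebra k Ω] [IsAlgClosure k Ω]
    -- the fixed cube root of unity and the two primes of `k`
    (ζ : 𝓞 k) (hζ : IsPrimitiveRoot ζ 3)
    (𝔭₁ 𝔭₂ : Ideal (𝓞 k)) (π₁ π₂ : 𝓞 k) (hne : 𝔭₁ ≠ 𝔭₂)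
    (h₁ : IsPrimaryGenerator ζ 𝔭₁ π₁) (h₂ : IsPrimaryGenerator ζ 𝔭₂ π₂)
    (h₁₂ : IsCubicResidueSymbol π₁ 𝔭₂ 1) (h₂₁ : IsCubicResidueSymbol π₂ 𝔭₁ 1)
    -- cube roots `ρ₁`, `ρ₂` of `π₁`, `π₂`; the field `K₁ = k(ρ₁)`, its automorphism `τ` and
    -- a prime `𝔓` of `K₁` over `𝔭₂`
    (ρ₁ ρ₂ : Ω) (hρ₁ : ρ₁ ^ 3 = algebraMap k Ω π₁) (hρ₂ : ρ₂ ^ 3 = algebraMap k Ω π₂)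
    (τ : k⟮ρ₁⟯ ≃ₐ[k] k⟮ρ₁⟯)
    (hτ : (τ (IntermediateField.AdjoinSimple.gen k ρ₁) : Ω) = algebraMap k Ω ζ * ρ₁)
    (𝔓 : Ideal (𝓞 k⟮ρ₁⟯)) (h𝔓 : 𝔓.IsPrime) (h𝔓₂ : 𝔓.LiesOver 𝔭₂)
    -- the integer `θ` and cube roots of its conjugates `θ`, `τ θ`, `τ² θ`
    (θ : 𝓞 k⟮ρ₁⟯) (hθ : IsAdmissible ζ π₂ τ 𝔓 θ)
    (t₁ t₂ t₃ : Ω) (ht₁ : t₁ ^ 3 = ((θ : k⟮ρ₁⟯) : Ω))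
    (ht₂ : t₂ ^ 3 = ((τ (θ : k⟮ρ₁⟯)) : Ω)) (ht₃ : t₃ ^ 3 = ((τ (τ (θ : k⟮ρ₁⟯))) : Ω))
    (R : IntermediateField k Ω) (hR : R = IntermediateField.adjoin k {ρ₁, ρ₂, t₁}) :
    R = IntermediateField.adjoin k {t₁, t₂, t₃} ∧
    IsGalois k R ∧
    (∀ (Q : Ideal (𝓞 R)) [Q.IsPrime], ¬ Q.LiesOver 𝔭₁ → ¬ Q.LiesOver 𝔭₂ →
      Algebra.IsUnramifiedAt (𝓞 k) Q) ∧
    IsUnramifiedAtInfinitePlaces k R ∧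
    (∀ Q : Ideal (𝓞 R), Q.IsPrime → (Q.LiesOver 𝔭₁ ∨ Q.LiesOver 𝔭₂) →
      Q.ramificationIdx (𝓞 k) = 3) ∧
    Nonempty ((R ≃ₐ[k] R) ≃* unitriangularGroup 3 (ZMod 3)) := by
  have : Normal k Ω := IsAlgClosure.normal k Ω
  have : IsTotallyComplex k := IsCyclotomicExtension.Rat.isTotallyComplex k (n := 3) (by norm_num)
  have h := h₁.isAdmissibleDatum h₂ hζ hne h₁₂ hρ₁ hτ
    (P := ⟨𝔓, h𝔓, h₂.ne_bot_of_liesOver h𝔓₂⟩) h𝔓₂ hθ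
  obtain ⟨n, x, hn, hdatum⟩ := h.exists_isTwistedKummerDatum hρ₂ ht₁
  have hroots := hdatum.adjoin_roots_eq hn h.apply_theta_ne (s := ![t₁, t₂, t₃]) <| by
    simpa only [Fin.forall_fin_succ] using ⟨ht₁, ht₂, ht₃, nofun⟩
  simp only [Matrix.range_cons, Matrix.range_empty, Set.union_empty, Set.singleton_union]
    at hroots
  have : Normal k R := hR ▸ hdatum.normal_adjoin_roots
  have : IsGalois k R := ⟨⟩
  have : FiniteDimensional k R := hR ▸ IntermediateField.finiteDimensional_adjoin
    fun y _ ↦ (Algebra.IsAlgebraic.isAlgebraic (R := k) y).isIntegral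
  have : NumberField R := NumberField.of_module_finite k R
  have hmem : {ρ₁, ρ₂, t₁} ⊆ (R : Set Ω) := hR ▸ IntermediateField.subset_adjoin _ _
  let : Algebra k⟮ρ₁⟯ R := (IntermediateField.inclusion
    (IntermediateField.adjoin_simple_le_iff.2 (hmem (by simp)))).toRingHom.toAlgebra
  have : IsScalarTower k k⟮ρ₁⟯ R := .of_algebraMap_eq fun _ ↦ rfl
  have : IsScalarTower k⟮ρ₁⟯ R Ω := .of_algebraMap_eq fun _ ↦ rfl
  have hL := h.isRedeiExtension (F := R) (ρ₂ := ⟨ρ₂, hmem (by simp)⟩) (t := ⟨t₁, hmem (by simp)⟩)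
    hρ₂ ht₁ hR
  exact ⟨hR.trans hroots, ‹_›,
    fun Q _ hQ₁ hQ₂ ↦ hL.isUnramifiedAt_of_not_liesOver h₁ h₂ hQ₁ hQ₂,
    isUnramifiedAtInfinitePlaces_of_isTotallyComplex k R,
    fun Q _ hQ ↦ hL.ramificationIdx_of_liesOver h₁ h₂ hQ, hL.nonempty_mulEquiv⟩
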